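/- **Proposition (Uniqueness).** Let $(\Sigma,g)$ be a compact smooth Riemannian manifold without boundary, of any finite dimension $d$ (in particular a compact Riemannian surface), let $\lambda>0$, let $\zeta$ be the Riemann zeta function, and consider the Cauchy problem $$(E)\qquad i\,\partial_t u+\Delta u+i\lambda\,u\,\zeta(|u|+1)=0\ \text{ on }\mathbb R_+\times\Sigma,\qquad u(0)=u_0\in H^1(\Sigma),$$ for complex-valued $u$, where $z\,\zeta(|z|+1)$ is understood to be $0$ at $z=0$. Here $H^1(\Sigma)$ is the completion of $C^\infty(\Sigma;\mathbb C)$ for the norm $\left(\int_\Sigma |\varphi|^2+\int_\Sigma|\nabla\varphi|_g^2\right)^{1/2}$, integrals being taken with respect to the Riemannian volume. A function $u\in L^\infty(\mathbb R_+;H^1(\Sigma))$ is a distributional solution of $(E)$ with initial data $u_0$ if for all $\theta\in C_c^\infty(\mathbb R;\mathbb R)$ and $\psi\in C^\infty(\Sigma;\mathbb C)$, with $(f,h)=\int_\Sigma f\,\bar h$, $$\int_0^\infty\Big[-i\,(u(t),\psi)\,\theta'(t)-(\nabla u(t),\nabla\psi)\,\theta(t)+i\lambda\,\big(u(t)\,\zeta(|u(t)|+1),\psi\big)\,\theta(t)\Big]\,dt=i\,(u_0,\psi)\,\theta(0).$$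 If $u_1,u_2\in L^\infty(\mathbb R_+;H^1(\Sigma))$ are two distributional solutions of $(E)$ with the same initial data $u_0\in H^1(\Sigma)$, then $u_1=u_2$. -/

import Mathlib

open MeasureTheory Set Filter Topology Manifold ContDiff Bundle
open scoped ComplexConjugate ENNReal NNReal

noncomputable section ZetaSchrodinger

lemma sum_orthonormal_eq (d : ℕ) {V ι : Type*} [NormedAddCommGroup V] [InnerProductSpace ℝ V]
    [Fintype ι] (o : OrthonormalBasis ι ℝ V) (v : Module.Basis (Fin d) ℝ V) (α β : V →ₗ[ℝ] ℂ) :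
    ∑ k, conj (α (o k)) * β (o k) =
      ∑ i, ∑ j, ((((Matrix.of fun i j => inner ℝ (v i) (v j))⁻¹ : Matrix (Fin d) (Fin d) ℝ) i j : ℝ) : ℂ)
        * (conj (α (v i)) * β (v j)) := by
  set G : Matrix (Fin d) (Fin d) ℝ := Matrix.of fun i j => inner ℝ (v i) (v j) with hG
  have hGdet : IsUnit G.det := by
    have : G = Matrix.gram ℝ v := rfl
    rw [this]
    exact (Matrix.det_gram_ne_zero_iff_linearIndependent.2 v.linearIndependent).isUnit
  set w : Fin d → V := fun i => ∑ k, G⁻¹ i k • v k with hw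
  have hwv : ∀ i j, inner ℝ (w i) (v j) = if i = j then (1 : ℝ) else 0 := fun i j => by
    have h := congrFun (congrFun (Matrix.nonsing_inv_mul G hGdet) i) j
    rw [Matrix.mul_apply, Matrix.one_apply] at h
    rw [← h, hw]
    simp [sum_inner, inner_smul_left, hG]
  have hrepr : ∀ x : V, x = ∑ i, (inner ℝ (w i) x : ℝ) • v i := fun x => by
    have h : ∀ i, inner ℝ (w i) x = v.repr x i := fun i => by
      have h' : inner ℝ (w i) x = inner ℝ (w i) (∑ j, v.repr x j • v j) := by rw [v.sum_repr]
      rw [h', inner_sum]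
      simp only [inner_smul_right, hwv]
      simp
    simp only [h]
    exact (v.sum_repr x).symm
  have hww : ∀ i j, inner ℝ (w i) (w j) = G⁻¹ i j := fun i j => by
    have hsymm : ∀ a b, G⁻¹ a b = G⁻¹ b a := fun a b => by
      have : G.transpose = G := by
        ext a b
        simp [hG, real_inner_comm]
      rw [← Matrix.transpose_apply G⁻¹, Matrix.transpose_nonsing_inv, this]
    rw [show inner ℝ (w i) (w j) = inner ℝ (w i) (∑ k, G⁻¹ j k • v k) from rfl]
    simp [inner_sum, inner_smul_right, hwv, hsymm j i]
  have hexp : ∀ (γ : V →ₗ[ℝ] ℂ) (k : ι), γ (o k) = ∑ i, ((inner ℝ (w i) (o k) : ℝ) : ℂ) * γ (v i) :=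
    fun γ k => by
      conv_lhs => rw [hrepr (o k)]
      simp [map_sum, map_smul]
  have hpars : ∀ i j, ∑ k, ((inner ℝ (w i) (o k) : ℝ) : ℂ) * ((inner ℝ (w j) (o k) : ℝ) : ℂ)
      = ((G⁻¹ i j : ℝ) : ℂ) := fun i j => by
    rw [← hww, ← o.sum_inner_mul_inner]
    push_cast
    exact Finset.sum_congr rfl fun k _ => by rw [real_inner_comm (w j)]
  simp only [hexp, map_sum, map_mul, Complex.conj_ofReal, Finset.sum_mul_sum]
  rw [Finset.sum_comm]
  refine Finset.sum_congr rfl fun i _ => ?_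
  rw [Finset.sum_comm]
  refine Finset.sum_congr rfl fun j _ => ?_
  rw [← hpars, Finset.sum_mul]
  exact Finset.sum_congr rfl fun k _ => by ring

section Metric

variable (d : ℕ) {M : Type*} [TopologicalSpace M] [ChartedSpace (EuclideanSpace ℝ (Fin d)) M]
  [IsManifold (𝓡 d) ∞ M]

/-- The coordinate vector fields `∂₁, …, ∂_d` of the preferred chart at `c`, evaluated at a point
`p` of the source of that chart (the value is `0` outside the source). -/
def coordFrame (c : M) (i : Fin d) (p : M) : TangentSpace (𝓡 d) p :=
  (trivializationAt (EuclideanSpace ℝ (Fin d)) (TangentSpace (𝓡 d) : M → Type _) c).localFrame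
    (EuclideanSpace.basisFun (Fin d) ℝ).toBasis i p

lemma coordFrame_contMDiffOn (c : M) (i : Fin d) :
    ContMDiffOn (𝓡 d) (𝓡 d).tangent ∞
      (fun p => (⟨p, coordFrame d c i p⟩ : TangentBundle (𝓡 d) M))
      (chartAt (EuclideanSpace ℝ (Fin d)) c).source := by
  exact (trivializationAt (EuclideanSpace ℝ (Fin d))
    (TangentSpace (𝓡 d) : M → Type _) c).contMDiffOn_localFrame_baseSet (I := 𝓡 d) ∞
    (EuclideanSpace.basisFun (Fin d) ℝ).toBasis i

/-- `∂ᵢ` is the image of the `i`-th standard basis vector under the derivative of the inverse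
chart. -/
lemma coordFrame_eq_mfderiv (c p : M) (i : Fin d)
    (hp : p ∈ (chartAt (EuclideanSpace ℝ (Fin d)) c).source) :
    coordFrame d c i p = mfderivWithin (𝓡 d) (𝓡 d) (extChartAt (𝓡 d) c).symm (range (𝓡 d))
      (extChartAt (𝓡 d) c p) (EuclideanSpace.single i (1 : ℝ)) := by
  have hp' : p ∈ (trivializationAt (EuclideanSpace ℝ (Fin d))
    (TangentSpace (𝓡 d) : M → Type _) c).baseSet := hp
  have h : coordFrame d c i p = (trivializationAt (EuclideanSpace ℝ (Fin d))
      (TangentSpace (𝓡 d) : M → Type _) c).symmL ℝ p (EuclideanSpace.single i (1 : ℝ)) := by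
    rw [coordFrame, Bundle.Trivialization.localFrame_apply_of_mem_baseSet _ _ hp',
      Bundle.Trivialization.symmL_apply _ hp']
    simp only [Bundle.Trivialization.basisAt, Module.Basis.map_apply,
      OrthonormalBasis.coe_toBasis, EuclideanSpace.basisFun_apply]
    rfl
  exact h.trans (DFunLike.congr_fun (TangentBundle.symmL_trivializationAt (I := 𝓡 d) hp) _)

variable [RiemannianBundle (fun x : M => TangentSpace (𝓡 d) x)]

/-- The matrix `(g_ij)`, `g_ij = g(∂ᵢ, ∂ⱼ)`, of the metric in the preferred chart at `c`. -/
def metricMatrix (c p : M) : Matrix (Fin d) (Fin d) ℝ :=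
  Matrix.of fun i j => inner ℝ (coordFrame d c i p) (coordFrame d c j p)

lemma metricMatrix_continuousOn
    [IsContMDiffRiemannianBundle (𝓡 d) ∞ (EuclideanSpace ℝ (Fin d))
      (fun x : M => TangentSpace (𝓡 d) x)] (c : M) :
    ContinuousOn (metricMatrix d c) (chartAt (EuclideanSpace ℝ (Fin d)) c).source := by
  refine continuousOn_pi.2 fun i => continuousOn_pi.2 fun j => ?_
  have h1 := ContMDiffOn.inner_bundle (IB := 𝓡 d) (n := ∞) (F := EuclideanSpace ℝ (Fin d)) (E := fun x : M => TangentSpace (𝓡 d) x)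
    (coordFrame_contMDiffOn d c i)
    (coordFrame_contMDiffOn d c j)
  exact h1.continuousOn

lemma metricMatrix_det_pos (c p : M) (hp : p ∈ (chartAt (EuclideanSpace ℝ (Fin d)) c).source) :
    0 < (metricMatrix d c p).det := by
  have h := (trivializationAt (EuclideanSpace ℝ (Fin d))
    (TangentSpace (𝓡 d) : M → Type _) c).isLocalFrameOn_localFrame_baseSet (𝓡 d) ∞
      (EuclideanSpace.basisFun (Fin d) ℝ).toBasis
  exact (Matrix.posDef_gram_of_linearIndependent (h.linearIndependent hp)).det_pos

end Metric

section Gradient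

variable (d : ℕ) {M : Type*} [TopologicalSpace M] [ChartedSpace (EuclideanSpace ℝ (Fin d)) M]

/-- The differential at `p` of a complex-valued function on `M`. -/
def diffC (φ : M → ℂ) (p : M) : TangentSpace (𝓡 d) p →L[ℝ] ℂ :=
  mfderiv (𝓡 d) 𝓘(ℝ, ℂ) φ p

instance (p : M) : FiniteDimensional ℝ (TangentSpace (𝓡 d) p) :=
  inferInstanceAs (FiniteDimensional ℝ (EuclideanSpace ℝ (Fin d)))

lemma diffC_add {φ ψ : M → ℂ} (hφ : ContMDiff (𝓡 d) 𝓘(ℝ, ℂ) ∞ φ)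
    (hψ : ContMDiff (𝓡 d) 𝓘(ℝ, ℂ) ∞ ψ) (p : M) :
    diffC d (φ + ψ) p = diffC d φ p + diffC d ψ p :=
  mfderiv_add (hφ.mdifferentiable (by simp) p) (hψ.mdifferentiable (by simp) p)

lemma diffC_smul {φ : M → ℂ} (hφ : ContMDiff (𝓡 d) 𝓘(ℝ, ℂ) ∞ φ) (z : ℂ) (p : M)
    (v : TangentSpace (𝓡 d) p) : diffC d (z • φ) p v = z * diffC d φ p v := by
  have h := (((ContinuousLinearMap.mul ℝ ℂ z).hasMFDerivAt (x := φ p)).comp p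
    (hφ.mdifferentiable (by simp) p).hasMFDerivAt).mfderiv
  have h' : diffC d (z • φ) p = (ContinuousLinearMap.mul ℝ ℂ z).comp (diffC d φ p) := h
  rw [h']
  rfl

variable [IsManifold (𝓡 d) ∞ M]

lemma diffC_coordFrame_continuousOn (φ : M → ℂ) (hφ : ContMDiff (𝓡 d) 𝓘(ℝ, ℂ) ∞ φ)
    (c : M) (i : Fin d) : ContinuousOn (fun p => diffC d φ p (coordFrame d c i p))
      (chartAt (EuclideanSpace ℝ (Fin d)) c).source := by
  have h1 : Continuous (tangentMap (𝓡 d) 𝓘(ℝ, ℂ) φ) := hφ.continuous_tangentMap (by simp)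
  have h2 := h1.comp_continuousOn (coordFrame_contMDiffOn d c i).continuousOn
  have h3 := (tangentBundleModelSpaceHomeomorph 𝓘(ℝ, ℂ)).continuous.comp_continuousOn h2
  exact continuous_snd.comp_continuousOn h3

variable [RiemannianBundle (fun x : M => TangentSpace (𝓡 d) x)]

/-- The pointwise Hermitian product `⟨∇φ, ∇ψ⟩_g` at `p` of the gradients of two complex-valued
functions, conjugate-linear in `φ`: the sum `∑ₖ conj (dφ(eₖ)) dψ(eₖ)` over a `g`-orthonormal basis
`(eₖ)` of the tangent space (it does not depend on the basis). -/
def gradInner (φ ψ : M → ℂ) (p : M) : ℂ :=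
  ∑ k, conj (diffC d φ p (stdOrthonormalBasis ℝ (TangentSpace (𝓡 d) p) k)) *
      diffC d ψ p (stdOrthonormalBasis ℝ (TangentSpace (𝓡 d) p) k)

lemma gradInner_eq_coord (φ ψ : M → ℂ) (c p : M)
    (hp : p ∈ (chartAt (EuclideanSpace ℝ (Fin d)) c).source) :
    gradInner d φ ψ p = ∑ i, ∑ j, (((metricMatrix d c p)⁻¹ i j : ℝ) : ℂ) *
      (conj (diffC d φ p (coordFrame d c i p)) * diffC d ψ p (coordFrame d c j p)) := by
  have hp' : p ∈ (trivializationAt (EuclideanSpace ℝ (Fin d))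
    (TangentSpace (𝓡 d) : M → Type _) c).baseSet := hp
  have := sum_orthonormal_eq d (stdOrthonormalBasis ℝ (TangentSpace (𝓡 d) p))
    ((trivializationAt (EuclideanSpace ℝ (Fin d))
      (TangentSpace (𝓡 d) : M → Type _) c).basisAt (EuclideanSpace.basisFun (Fin d) ℝ).toBasis hp')
    (diffC d φ p) (diffC d ψ p)
  have e : ∀ i, (trivializationAt (EuclideanSpace ℝ (Fin d))
      (TangentSpace (𝓡 d) : M → Type _) c).basisAt (EuclideanSpace.basisFun (Fin d) ℝ).toBasis hp' i
      = coordFrame d c i p := fun i => by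
    rw [coordFrame, Bundle.Trivialization.localFrame_apply_of_mem_baseSet _ _ hp']
  simp only [e] at this
  exact this

lemma gradInner_continuous
    [IsContMDiffRiemannianBundle (𝓡 d) ∞ (EuclideanSpace ℝ (Fin d))
      (fun x : M => TangentSpace (𝓡 d) x)]
    (φ ψ : M → ℂ) (hφ : ContMDiff (𝓡 d) 𝓘(ℝ, ℂ) ∞ φ) (hψ : ContMDiff (𝓡 d) 𝓘(ℝ, ℂ) ∞ ψ) :
    Continuous (gradInner d φ ψ) := by
  refine continuous_iff_continuousAt.2 fun c => ?_
  set U := (chartAt (EuclideanSpace ℝ (Fin d)) c).source with hU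
  have hUo : U ∈ 𝓝 c := (chartAt (EuclideanSpace ℝ (Fin d)) c).open_source.mem_nhds
    (mem_chart_source _ c)
  have hG := metricMatrix_continuousOn d c
  have hinv : ∀ i j, ContinuousOn (fun p => (metricMatrix d c p)⁻¹ i j) U := fun i j => by
    have h1 : ContinuousOn (fun p => (metricMatrix d c p)⁻¹) U := by
      have hdet : ContinuousOn (fun p => (metricMatrix d c p).det) U :=
        (Continuous.matrix_det continuous_id).comp_continuousOn hG
      have hadj : ContinuousOn (fun p => (metricMatrix d c p).adjugate) U :=
        (Continuous.matrix_adjugate continuous_id).comp_continuousOn hG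
      have : ContinuousOn (fun p => (metricMatrix d c p).det⁻¹ • (metricMatrix d c p).adjugate) U :=
        (hdet.inv₀ fun p hp => (metricMatrix_det_pos d c p hp).ne').smul hadj
      refine this.congr fun p _ => ?_
      simp [Matrix.inv_def]
    exact (continuous_apply_apply i j).comp_continuousOn h1
  refine ContinuousOn.continuousAt (s := U) ?_ hUo
  refine ContinuousOn.congr ?_ fun p hp => gradInner_eq_coord d φ ψ c p hp
  refine continuousOn_finsetSum _ fun i _ => continuousOn_finsetSum _ fun j _ => ?_
  exact (Complex.continuous_ofReal.comp_continuousOn (hinv i j)).mul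
    ((Complex.continuous_conj.comp_continuousOn (diffC_coordFrame_continuousOn d φ hφ c i)).mul
      (diffC_coordFrame_continuousOn d ψ hψ c j))

end Gradient

section Volume

variable (d : ℕ) (M : Type*) [TopologicalSpace M] [ChartedSpace (EuclideanSpace ℝ (Fin d)) M]
  [IsManifold (𝓡 d) ∞ M] [RiemannianBundle (fun x : M => TangentSpace (𝓡 d) x)]
  [MeasurableSpace M]

/-- The volume `√det(g_ij) dx₁⋯dx_d` on the source of the preferred chart at `c`, as a measure
on `M` (carried by that source). -/
def chartVolume {M : Type*} [TopologicalSpace M] [ChartedSpace (EuclideanSpace ℝ (Fin d)) M]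
    [IsManifold (𝓡 d) ∞ M] [RiemannianBundle (fun x : M => TangentSpace (𝓡 d) x)]
    [MeasurableSpace M] (c : M) : Measure M :=
  (Measure.map (chartAt (EuclideanSpace ℝ (Fin d)) c).symm
    ((volume : Measure (EuclideanSpace ℝ (Fin d))).restrict
      (chartAt (EuclideanSpace ℝ (Fin d)) c).target)).withDensity
    fun p => ENNReal.ofReal √(metricMatrix d c p).det

variable [T2Space M] [CompactSpace M]

/-- A smooth partition of unity subordinate to the preferred charts of `M`. -/
def chartPartition (M : Type*) [TopologicalSpace M] [ChartedSpace (EuclideanSpace ℝ (Fin d)) M]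
    [IsManifold (𝓡 d) ∞ M] [T2Space M] [CompactSpace M] :
    SmoothPartitionOfUnity M (𝓡 d) M univ :=
  (SmoothPartitionOfUnity.exists_isSubordinate_chartAt_source (𝓡 d) M).choose

/-- The Riemannian volume measure of `M`: the local volumes `√det(g_ij) dx` glued by a partition
of unity `(ρ_c)` subordinate to the charts, `∫ f dvol = ∑_c ∫ ρ_c f √det(g_ij) dx`. -/
def riemVolume : Measure M :=
  Measure.sum fun c : M =>
    (chartVolume d c).withDensity fun p => ENNReal.ofReal (chartPartition d M c p)

instance riemVolume_isFinite [BorelSpace M]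
    [IsContMDiffRiemannianBundle (𝓡 d) ∞ (EuclideanSpace ℝ (Fin d))
      (fun x : M => TangentSpace (𝓡 d) x)] : IsFiniteMeasure (riemVolume d M) := by
  have hfin : (Function.support fun c : M => (chartVolume d c).withDensity
      fun p => ENNReal.ofReal (chartPartition d M c p)).Finite := by
    refine ((chartPartition d M).locallyFinite.finite_nonempty_of_compact).subset fun c hc => ?_
    by_contra hne
    refine hc ?_
    have h0 : ∀ p, chartPartition d M c p = 0 := fun p => by
      by_contra hp
      exact hne ⟨p, hp⟩
    simp [h0]
  have hpart : ∀ c : M, ((chartVolume d c).withDensity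
      fun p => ENNReal.ofReal (chartPartition d M c p)) univ < ⊤ := fun c => by
    set e := chartAt (EuclideanSpace ℝ (Fin d)) c with he
    set K := tsupport (chartPartition d M c) with hK
    have hKs : K ⊆ e.source :=
      (SmoothPartitionOfUnity.exists_isSubordinate_chartAt_source (𝓡 d) M).choose_spec c
    have hKc : IsCompact K := (isClosed_tsupport _).isCompact
    have hKm : MeasurableSet K := (isClosed_tsupport _).measurableSet
    obtain ⟨C, hC⟩ := hKc.bddAbove_image (f := fun p => √(metricMatrix d c p).det)
      ((Real.continuous_sqrt.comp_continuousOn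
        ((Continuous.matrix_det continuous_id).comp_continuousOn
          (metricMatrix_continuousOn d c))).mono hKs)
    have hmap : (Measure.map e.symm (volume.restrict e.target)) K < ⊤ := by
      have hae : AEMeasurable e.symm (volume.restrict e.target) :=
        e.continuousOn_symm.aemeasurable e.open_target.measurableSet
      rw [Measure.map_apply_of_aemeasurable hae hKm]
      refine lt_of_le_of_lt ?_ ((hKc.image_of_continuousOn
        (e.continuousOn.mono hKs)).measure_lt_top (μ := volume))
      have hnull : NullMeasurableSet (e.symm ⁻¹' K) (volume.restrict e.target) :=
        hae.nullMeasurable hKm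
      rw [Measure.restrict_apply₀ hnull]
      refine measure_mono fun y hy => ⟨e.symm y, hy.1, e.right_inv hy.2⟩
    have hvol : chartVolume d c K < ⊤ := by
      rw [chartVolume, withDensity_apply _ hKm]
      refine lt_of_le_of_lt (setLIntegral_mono' hKm (g := fun _ => ENNReal.ofReal C) fun p hp =>
        ENNReal.ofReal_le_ofReal (hC ⟨p, hp, rfl⟩)) ?_
      rw [setLIntegral_const]
      exact ENNReal.mul_lt_top ENNReal.ofReal_lt_top hmap
    rw [withDensity_apply _ MeasurableSet.univ, Measure.restrict_univ]
    refine lt_of_le_of_lt (lintegral_mono (g := K.indicator fun _ => 1) fun p => ?_) ?_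
    · by_cases hp : p ∈ K
      · simpa [hp] using (chartPartition d M).le_one c p
      · simp [hp, image_eq_zero_of_notMem_tsupport hp]
    · rw [lintegral_indicator hKm]
      simpa using hvol
  refine ⟨?_⟩
  rw [riemVolume, Measure.sum_apply _ MeasurableSet.univ]
  rw [tsum_eq_sum (s := hfin.toFinset) fun c hc => ?_]
  · exact ENNReal.sum_lt_top.2 fun c _ => hpart c
  · have : (chartVolume d c).withDensity
      (fun p => ENNReal.ofReal (chartPartition d M c p)) = 0 := by
      by_contra h
      exact hc (hfin.mem_toFinset.2 h)
    rw [this]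
    rfl

end Volume

section Sobolev

variable (d : ℕ) (M : Type*) [TopologicalSpace M] [ChartedSpace (EuclideanSpace ℝ (Fin d)) M]

/-- The complex vector space `C^∞(M; ℂ)`. -/
def smoothSubmodule : Submodule ℂ (M → ℂ) where
  carrier := {φ | ContMDiff (𝓡 d) 𝓘(ℝ, ℂ) ∞ φ}
  add_mem' hφ hψ := hφ.add hψ
  zero_mem' := contMDiff_const
  smul_mem' z _ hφ := (ContinuousLinearMap.mul ℝ ℂ z).contMDiff.comp hφ

/-- `C^∞(M; ℂ)` as a type of its own, to be endowed with the `H¹` inner product. -/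
def SmoothFn : Type _ := smoothSubmodule d M

instance : AddCommGroup (SmoothFn d M) := inferInstanceAs (AddCommGroup (smoothSubmodule d M))

instance : Module ℂ (SmoothFn d M) := inferInstanceAs (Module ℂ (smoothSubmodule d M))

instance : CoeFun (SmoothFn d M) (fun _ => M → ℂ) := ⟨fun φ => φ.1⟩

variable {d M} in
lemma SmoothFn.contMDiff (φ : SmoothFn d M) : ContMDiff (𝓡 d) 𝓘(ℝ, ℂ) ∞ φ := φ.2

variable {d M} in
lemma SmoothFn.continuous (φ : SmoothFn d M) : Continuous φ := φ.contMDiff.continuous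

variable [T2Space M] [CompactSpace M] [IsManifold (𝓡 d) ∞ M]
  [RiemannianBundle (fun x : M => TangentSpace (𝓡 d) x)]
  [IsContMDiffRiemannianBundle (𝓡 d) ∞ (EuclideanSpace ℝ (Fin d))
    (fun x : M => TangentSpace (𝓡 d) x)]
  [MeasurableSpace M] [BorelSpace M]

lemma integrable_riemVolume {f : M → ℂ} (hf : Continuous f) : Integrable f (riemVolume d M) :=
  hf.integrable_of_hasCompactSupport (HasCompactSupport.of_compactSpace f)

/-- The (semi-definite) `H¹` inner product `∫ φ̄ ψ dvol + ∫ ⟨∇φ, ∇ψ⟩ dvol` on `C^∞(M; ℂ)`. -/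
@[reducible] def h1Core : PreInnerProductSpace.Core ℂ (SmoothFn d M) where
  inner φ ψ := (∫ p, conj (φ p) * ψ p ∂(riemVolume d M)) +
    ∫ p, gradInner d φ ψ p ∂(riemVolume d M)
  conj_inner_symm φ ψ := by
    rw [map_add, ← integral_conj, ← integral_conj]
    congr 1
    · exact integral_congr_ae (.of_forall fun p => by simp [mul_comm])
    · exact integral_congr_ae (.of_forall fun p => by simp [gradInner, mul_comm])
  re_inner_nonneg φ := by
    rw [map_add]
    refine add_nonneg ?_ ?_
    · have h : Integrable (fun p => conj (φ p) * φ p) (riemVolume d M) := integrable_riemVolume d M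
        ((Complex.continuous_conj.comp φ.continuous).mul φ.continuous)
      refine le_of_le_of_eq ?_ (integral_re h)
      refine integral_nonneg fun p => ?_
      simp only [← Complex.normSq_eq_conj_mul_self]
      simpa using Complex.normSq_nonneg _
    · rw [← integral_re (integrable_riemVolume d M
        (gradInner_continuous d φ φ φ.contMDiff φ.contMDiff))]
      refine integral_nonneg fun p => ?_
      simp only [gradInner, map_sum, ← Complex.normSq_eq_conj_mul_self]
      exact Finset.sum_nonneg fun k _ => by simpa using Complex.normSq_nonneg _
  add_left φ ψ χ := by
    have h1 : ∀ p, conj ((φ + ψ : SmoothFn d M) p) * χ p =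
        conj (φ p) * χ p + conj (ψ p) * χ p := fun p => by
      change conj (φ p + ψ p) * χ p = _
      rw [map_add, add_mul]
    have h2 : ∀ p, gradInner d (φ + ψ : SmoothFn d M) χ p =
        gradInner d φ χ p + gradInner d ψ χ p := fun p => by
      have : diffC d (φ + ψ : SmoothFn d M) p = diffC d φ p + diffC d ψ p :=
        diffC_add d φ.contMDiff ψ.contMDiff p
      simp [gradInner, this, add_mul, Finset.sum_add_distrib]
    simp only [h1, h2]
    rw [integral_add, integral_add]
    · ring
    · exact integrable_riemVolume d M (gradInner_continuous d φ χ φ.contMDiff χ.contMDiff)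
    · exact integrable_riemVolume d M (gradInner_continuous d ψ χ ψ.contMDiff χ.contMDiff)
    · exact integrable_riemVolume d M
        ((Complex.continuous_conj.comp φ.continuous).mul χ.continuous)
    · exact integrable_riemVolume d M
        ((Complex.continuous_conj.comp ψ.continuous).mul χ.continuous)
  smul_left φ χ z := by
    have h1 : ∀ p, conj ((z • φ : SmoothFn d M) p) * χ p = conj z * (conj (φ p) * χ p) :=
      fun p => by
        change conj (z * φ p) * χ p = _
        rw [map_mul, mul_assoc]
    have h2 : ∀ p, gradInner d (z • φ : SmoothFn d M) χ p = conj z * gradInner d φ χ p :=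
      fun p => by
        have : ∀ v, diffC d (z • φ : SmoothFn d M) p v = z * diffC d φ p v :=
          fun v => diffC_smul d φ.contMDiff z p v
        simp [gradInner, this, Finset.mul_sum, mul_assoc]
    simp only [h1, h2, integral_const_mul]
    ring

instance : SeminormedAddCommGroup (SmoothFn d M) :=
  @InnerProductSpace.Core.toSeminormedAddCommGroup ℂ (SmoothFn d M) _ _ _ (h1Core d M)

instance : InnerProductSpace ℂ (SmoothFn d M) := InnerProductSpace.ofCore (h1Core d M)

lemma smoothFn_inner (φ ψ : SmoothFn d M) :
    inner ℂ φ ψ = (∫ p, conj (φ p) * ψ p ∂(riemVolume d M)) +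
      ∫ p, gradInner d φ ψ p ∂(riemVolume d M) := rfl

/-- The Sobolev space `H¹(M) = H¹(M; ℂ)`: the completion of `C^∞(M; ℂ)` for the norm
`(∫ |φ|² dvol + ∫ |∇φ|² dvol)^{1/2}`. -/
abbrev H1 : Type _ := UniformSpace.Completion (SmoothFn d M)

lemma SmoothFn.memLp (φ : SmoothFn d M) : MemLp φ 2 (riemVolume d M) := by
  obtain ⟨C, hC⟩ := (isCompact_univ (X := M)).exists_bound_of_continuousOn φ.continuous.continuousOn
  exact MemLp.of_bound φ.continuous.aestronglyMeasurable C (.of_forall fun p => hC p (mem_univ p))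

/-- The class in `L²(M; ℂ)` of a smooth function, as a linear map. -/
def smoothToL2Lin : SmoothFn d M →ₗ[ℂ] Lp ℂ 2 (riemVolume d M) where
  toFun φ := (SmoothFn.memLp d M φ).toLp φ
  map_add' φ ψ := MemLp.toLp_add (SmoothFn.memLp d M φ) (SmoothFn.memLp d M ψ)
  map_smul' z φ := MemLp.toLp_const_smul z (SmoothFn.memLp d M φ)

lemma smoothToL2Lin_inner (φ ψ : SmoothFn d M) :
    inner ℂ (smoothToL2Lin d M φ) (smoothToL2Lin d M ψ) =
      ∫ p, conj (φ p) * ψ p ∂(riemVolume d M) := by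
  rw [L2.inner_def]
  refine integral_congr_ae ?_
  filter_upwards [(SmoothFn.memLp d M φ).coeFn_toLp, (SmoothFn.memLp d M ψ).coeFn_toLp]
    with p h1 h2
  change inner ℂ ((SmoothFn.memLp d M φ).toLp φ p) ((SmoothFn.memLp d M ψ).toLp ψ p) = _
  rw [h1, h2]
  simp [mul_comm]

lemma smoothToL2Lin_norm_le (φ : SmoothFn d M) : ‖smoothToL2Lin d M φ‖ ≤ 1 * ‖φ‖ := by
  rw [one_mul]
  refine le_of_sq_le_sq ?_ (norm_nonneg _)
  rw [@norm_sq_eq_re_inner ℂ, @norm_sq_eq_re_inner ℂ, smoothToL2Lin_inner, smoothFn_inner, map_add]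
  refine le_add_of_nonneg_right ?_
  rw [← integral_re (integrable_riemVolume d M
    (gradInner_continuous d φ φ φ.contMDiff φ.contMDiff))]
  refine integral_nonneg fun p => ?_
  simp only [gradInner, map_sum, ← Complex.normSq_eq_conj_mul_self]
  exact Finset.sum_nonneg fun k _ => by simpa using Complex.normSq_nonneg _

/-- The inclusion `H¹(M) → L²(M; ℂ)`. -/
def toL2 : H1 d M →L[ℂ] Lp ℂ 2 (riemVolume d M) :=
  ((smoothToL2Lin d M).mkContinuous 1 (smoothToL2Lin_norm_le d M)).fromCompletion

lemma toL2_coe (φ : SmoothFn d M) :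
    toL2 d M (φ : H1 d M) = (SmoothFn.memLp d M φ).toLp φ := by
  exact ContinuousLinearMap.fromCompletion_apply_coe _ φ

/-- The Dirichlet form `(v, u) ↦ ∫ ⟨∇v, ∇u⟩ dvol` on `H¹(M)`, conjugate-linear in `v`: the `H¹`
inner product minus the `L²` inner product. -/
def dirichlet (v u : H1 d M) : ℂ := inner ℂ v u - inner ℂ (toL2 d M v) (toL2 d M u)

lemma dirichlet_coe (φ ψ : SmoothFn d M) :
    dirichlet d M φ ψ = ∫ p, gradInner d φ ψ p ∂(riemVolume d M) := by
  have h : inner ℂ (toL2 d M (φ : H1 d M)) (toL2 d M (ψ : H1 d M)) =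
      ∫ p, conj (φ p) * ψ p ∂(riemVolume d M) := by
    rw [toL2_coe, toL2_coe]
    exact smoothToL2Lin_inner d M φ ψ
  rw [dirichlet, h, UniformSpace.Completion.inner_coe, smoothFn_inner]
  ring

end Sobolev

section Equation

/-- The nonlinearity `z ↦ z ζ(|z| + 1)`; its value at `z = 0` is `0`. -/
def zetaNonlinearity (z : ℂ) : ℂ := z * riemannZeta ((‖z‖ : ℂ) + 1)

variable (d : ℕ) {M : Type*} [TopologicalSpace M] [ChartedSpace (EuclideanSpace ℝ (Fin d)) M]
  [T2Space M] [CompactSpace M] [IsManifold (𝓡 d) ∞ M]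
  [RiemannianBundle (fun x : M => TangentSpace (𝓡 d) x)]
  [IsContMDiffRiemannianBundle (𝓡 d) ∞ (EuclideanSpace ℝ (Fin d))
    (fun x : M => TangentSpace (𝓡 d) x)]
  [MeasurableSpace M] [BorelSpace M]

/-- `u ∈ L^∞(ℝ₊; H¹(M))` is a distributional solution of the Cauchy problem
`i ∂ₜu + Δu + i λ u ζ(|u| + 1) = 0`, `u(0) = u₀`: for all test functions `θ ∈ C_c^∞(ℝ)` and
`ψ ∈ C^∞(M; ℂ)`, with `(f, g) = ∫ f ḡ dvol`,
`∫₀^∞ [-i (u, ψ) θ' - (∇u, ∇ψ) θ + i λ (u ζ(|u| + 1), ψ) θ] dt = i (u₀, ψ) θ(0)`.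
The test functions `θ` vanishing near `0` give the equation in `(0, ∞) × M`, the others give the
initial condition. -/
def IsDistribSolution (lam : ℝ) (u₀ : H1 d M)
    (u : Lp (H1 d M) ∞ ((volume : Measure ℝ).restrict (Ici 0))) : Prop :=
  ∀ (θ : ℝ → ℝ) (ψ : SmoothFn d M), ContDiff ℝ ∞ θ → HasCompactSupport θ →
    ∫ t in Ici (0 : ℝ),
      (-(Complex.I * inner ℂ (toL2 d M ψ) (toL2 d M (u t)) * ((deriv θ t : ℝ) : ℂ))
        - dirichlet d M ψ (u t) * (θ t : ℂ)
        + Complex.I * lam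
          * (∫ p, zetaNonlinearity (toL2 d M (u t) p) * conj (ψ p) ∂(riemVolume d M)) * (θ t : ℂ))
      = Complex.I * inner ℂ (toL2 d M ψ) (toL2 d M u₀) * (θ 0 : ℂ)

end Equation

end ZetaSchrodinger

/-!
Since `i Δ` is skew-adjoint on `L²`, the difference `w = u₁ - u₂` of two solutions satisfies,
formally, `d/dt ‖w‖² = -2 lam Re ⟨w, F(u₁) - F(u₂)⟩` in `L²`, with `F(z) = z ζ(|z| + 1)`. Uniqueness
follows from Grönwall's inequality once `F` is monotone up to a Lipschitz error.

*The nonlinearity.* Since `ζ` has a simple pole of residue `1` at `1`, `F(z) = z / |z| + L(z)`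
(`zetaNonlinearity_eq`). The first term is a subgradient of the convex function `|z|`, hence
monotone although discontinuous at `0` (`unitVector_monotone`). The second is Lipschitz, because
`s ↦ s ζ(s + 1)` is Lipschitz on `[0, ∞)`: near `0` it extends to an entire function, and on
`[1, ∞)` its Dirichlet series can be estimated term by term (`exists_lipschitzOnWith_riemannZeta₁`).

*The energy identity.* Let `J : H¹ → L²` be the inclusion, a contraction. The Dirichlet form is
represented in `H¹` by `A = 1 - J† J`, so the equation becomes `(J† J w)' = -i A w - lam J† G`,
with `G = F(u₁) - F(u₂)`, an equation between bounded functions with values in `H¹`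
(`IsDistribSolution.integral_weakIntegrand`); hence `y = J† J w` is Lipschitz with `y(0) = 0`
(`ae_eq_primitive_of_weak_deriv`). The function `w` itself is only measurable, so `⟨w, y⟩` cannot
be differentiated. The geometric sums `Rₙ = ∑_{k < n} Aᵏ` satisfy `Rₙ J† J = 1 - Aⁿ`, and
`⟨Rₙ y, y⟩` is Lipschitz; its derivative is `-2 lam Re ⟨J (1 - Aⁿ) w, G⟩`, as `(1 - Aⁿ) A` is
self-adjoint. Finally `J Aⁿ x → 0` for each `x` (`tendsto_apply_defectOp_pow`), which yields
`‖J w(t)‖² = -2 lam ∫₀ᵗ Re ⟨J w, G⟩` (`energy_identity`).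

*Conclusion.* Grönwall gives `J w = 0`, hence `G = 0`. The equation then reduces to `-i w = 0` in
`H¹` (`ae_eq_zero_of_weak_evolution`); in this way the injectivity of `H¹ → L²`, that is, the
closability of the gradient, is not needed.
-/

/-! ### The function `s ↦ s ζ(s + 1)` is Lipschitz on `[0, ∞)` -/

/-- Each term of the series of `s ζ(s + 1)` is Lipschitz on `[1, ∞)`; with `L = log (n + 1)` the
term is `s e^{-(s + 1) L}`, and the constants `2 e^{-3 L / 2} = 2 (n + 1)^{-3/2}` are summable. -/
lemma lipschitz_mul_exp_neg {L : ℝ} (hL : 0 ≤ L) {s t : ℝ} (hs : 1 ≤ s) (ht : 1 ≤ t) :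
    ‖s * Real.exp (-(s + 1) * L) - t * Real.exp (-(t + 1) * L)‖ ≤
      2 * Real.exp (-(3 / 2) * L) * ‖s - t‖ := by
  have hder : ∀ x ∈ Ici (1 : ℝ), HasDerivWithinAt (fun x : ℝ => x * Real.exp (-(x + 1) * L))
      (Real.exp (-(x + 1) * L) * (1 - x * L)) (Ici 1) x := fun x _ => by
    have h1 : HasDerivAt (fun x : ℝ => -(x + 1) * L) (-1 * L) x :=
      (((hasDerivAt_id x).add_const 1).neg).mul_const L
    have h2 := (hasDerivAt_id x).mul h1.exp
    refine HasDerivAt.hasDerivWithinAt ?_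
    convert! h2 using 1
    simp only [id]
    ring
  refine (convex_Ici (1 : ℝ)).norm_image_sub_le_of_norm_hasDerivWithin_le hder ?_ ht hs
  intro x hx
  have hx : 1 ≤ x := hx
  have hxL : 0 ≤ x * L := by positivity
  rw [norm_mul, Real.norm_of_nonneg (Real.exp_nonneg _)]
  have h1 : ‖1 - x * L‖ ≤ 2 * Real.exp (x * L / 2) := by
    have := Real.add_one_le_exp (x * L / 2)
    rw [Real.norm_eq_abs, abs_le]
    constructor <;> linarith
  calc Real.exp (-(x + 1) * L) * ‖1 - x * L‖
      ≤ Real.exp (-(x + 1) * L) * (2 * Real.exp (x * L / 2)) := by gcongr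
    _ = 2 * Real.exp (-(x + 1) * L + x * L / 2) := by rw [Real.exp_add]; ring
    _ ≤ 2 * Real.exp (-(3 / 2) * L) := by
      gcongr
      nlinarith

lemma riemannZeta₁_ofReal_add_one {s : ℝ} (hs : s ≠ 0) :
    riemannZeta₁ ((s : ℂ) + 1) = s * riemannZeta ((s : ℂ) + 1) := by
  have h : (s : ℂ) ≠ 0 := by exact_mod_cast hs
  rw [riemannZeta_eq_inv_sub_mul (by simpa using h)]
  simp [h]

lemma hasSum_mul_exp_neg_riemannZeta₁ {s : ℝ} (hs : 0 < s) :
    HasSum (fun n : ℕ => ((s * Real.exp (-(s + 1) * Real.log (n + 1)) : ℝ) : ℂ))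
      (riemannZeta₁ ((s : ℂ) + 1)) := by
  have h1 : 1 < ((s : ℂ) + 1).re := by simpa using hs
  have hsum : Summable fun n : ℕ => 1 / ((n : ℂ) + 1) ^ ((s : ℂ) + 1) := by
    have := (summable_nat_add_iff 1).2 (Complex.summable_one_div_nat_cpow.2 h1)
    simpa using this
  rw [riemannZeta₁_ofReal_add_one hs.ne', zeta_eq_tsum_one_div_nat_add_one_cpow h1]
  convert! hsum.hasSum.mul_left (s : ℂ) using 2 with n
  have hn : (0 : ℝ) < (n : ℝ) + 1 := by positivity
  have : 1 / ((n : ℂ) + 1) ^ ((s : ℂ) + 1) =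
      ((Real.exp (-(s + 1) * Real.log (n + 1)) : ℝ) : ℂ) := by
    rw [mul_comm, ← Real.rpow_def_of_pos hn, Real.rpow_neg hn.le, Complex.ofReal_inv,
      Complex.ofReal_cpow hn.le]
    simp
  rw [this]
  push_cast
  rfl

lemma exists_lipschitzOnWith_riemannZeta₁_Ici_one :
    ∃ C : ℝ≥0, LipschitzOnWith C (fun s : ℝ => riemannZeta₁ ((s : ℂ) + 1)) (Ici 1) := by
  have hsum : Summable fun n : ℕ => 2 * Real.exp (-(3 / 2) * Real.log (n + 1)) := by
    have h := (summable_nat_add_iff 1).2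
      (Real.summable_nat_rpow.2 (show (-(3 / 2) : ℝ) < -1 by norm_num))
    refine (h.mul_left 2).congr fun n => ?_
    have hn : (0 : ℝ) < (n : ℝ) + 1 := by positivity
    push_cast
    rw [Real.rpow_def_of_pos hn, mul_comm (Real.log _)]
  refine ⟨(∑' n : ℕ, 2 * Real.exp (-(3 / 2) * Real.log (n + 1))).toNNReal,
    LipschitzOnWith.of_dist_le_mul fun s hs t ht => ?_⟩
  have hs : 1 ≤ s := hs
  have ht : 1 ≤ t := ht
  have h := (hasSum_mul_exp_neg_riemannZeta₁ (s := s) (by linarith)).sub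
    (hasSum_mul_exp_neg_riemannZeta₁ (s := t) (by linarith))
  rw [dist_eq_norm, ← h.tsum_eq, dist_eq_norm,
    Real.coe_toNNReal _ (tsum_nonneg fun n => by positivity), ← tsum_mul_right]
  refine tsum_of_norm_bounded (hsum.mul_right ‖s - t‖).hasSum fun n => ?_
  rw [← Complex.ofReal_sub, Complex.norm_real]
  exact lipschitz_mul_exp_neg (Real.log_nonneg (by linarith [(Nat.cast_nonneg n : (0 : ℝ) ≤ n)]))
    hs ht

lemma exists_lipschitzOnWith_riemannZeta₁ :
    ∃ C : ℝ≥0, LipschitzOnWith C (fun s : ℝ => riemannZeta₁ ((s : ℂ) + 1)) (Ici 0) := by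
  have hcd : ContDiff ℝ 1 (fun s : ℝ => riemannZeta₁ ((s : ℂ) + 1)) := by
    have h1 : ContDiff ℝ 1 riemannZeta₁ :=
      (differentiable_riemannZeta₁.contDiff (n := 1)).restrict_scalars ℝ
    exact h1.comp (Complex.ofRealCLM.contDiff.add contDiff_const)
  obtain ⟨A, hA⟩ := hcd.contDiffOn.exists_lipschitzOnWith (s := Icc 0 1) (by simp)
    (convex_Icc _ _) isCompact_Icc
  obtain ⟨B, hB⟩ := exists_lipschitzOnWith_riemannZeta₁_Ici_one
  set k : ℝ → ℂ := fun s : ℝ => riemannZeta₁ ((s : ℂ) + 1)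
  refine ⟨A + B, LipschitzOnWith.of_dist_le_mul fun s hs t ht => ?_⟩
  have hs : 0 ≤ s := hs
  have ht : 0 ≤ t := ht
  -- the decomposition `k s = k (min s 1) + k (max s 1) - k 1` separates the two ranges
  have hmin : ∀ x : ℝ, 0 ≤ x → min x 1 ∈ Icc (0 : ℝ) 1 := fun x hx =>
    ⟨le_min hx zero_le_one, min_le_right _ _⟩
  have hk : ∀ x : ℝ, k x = k (min x 1) + (k (max x 1) - k 1) := fun x => by
    rcases le_total x 1 with h | h <;> simp [h]
  have h1 := hA.dist_le_mul _ (hmin s hs) _ (hmin t ht)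
  have h2 := hB.dist_le_mul _ (le_max_right s 1) _ (le_max_right t 1)
  have h3 : dist (min s 1) (min t 1) ≤ dist s t := by
    simpa [Real.dist_eq] using abs_min_sub_min_le_max s 1 t 1
  have h4 : dist (max s 1) (max t 1) ≤ dist s t := by
    simpa [Real.dist_eq] using abs_max_sub_max_le_max s 1 t 1
  calc dist (k s) (k t)
      ≤ dist (k (min s 1)) (k (min t 1)) + dist (k (max s 1)) (k (max t 1)) := by
        rw [hk s, hk t]
        refine (dist_add_add_le _ _ _ _).trans ?_
        rw [dist_sub_right]
    _ ≤ A * dist s t + B * dist s t := by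
        refine add_le_add (h1.trans ?_) (h2.trans ?_) <;> gcongr
    _ = ↑(A + B) * dist s t := by push_cast; ring

/-! ### The nonlinearity is the sum of a monotone and a Lipschitz map -/

/-- The unit vector `z / |z|`, with value `0` at `0`: the subgradient of least norm of `|z|`. -/
noncomputable def unitVector (z : ℂ) : ℂ := z / ‖z‖

lemma norm_unitVector_le (z : ℂ) : ‖unitVector z‖ ≤ 1 := by
  rw [unitVector, norm_div, Complex.norm_real, norm_norm]
  exact div_self_le_one _

lemma norm_mul_unitVector (z : ℂ) : ‖z‖ * unitVector z = z := by
  rcases eq_or_ne z 0 with rfl | hz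
  · simp [unitVector]
  · have : (‖z‖ : ℂ) ≠ 0 := by simpa using hz
    rw [unitVector]
    field_simp

@[simp] lemma unitVector_zero : unitVector 0 = 0 := by simp [unitVector]

lemma re_inner_unitVector_le (z w : ℂ) : (inner ℂ z (unitVector w)).re ≤ ‖z‖ := by
  refine (Complex.re_le_norm _).trans ((norm_inner_le_norm _ _).trans ?_)
  simpa using mul_le_mul_of_nonneg_left (norm_unitVector_le w) (norm_nonneg z)

lemma re_inner_self_unitVector (z : ℂ) : (inner ℂ z (unitVector z)).re = ‖z‖ := by
  rcases eq_or_ne z 0 with rfl | hz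
  · simp
  · have hz' : (‖z‖ : ℂ) ≠ 0 := by simpa using hz
    have : inner ℂ z (unitVector z) = (‖z‖ : ℂ) := by
      rw [RCLike.inner_apply, unitVector, div_mul_eq_mul_div, Complex.mul_conj,
        Complex.normSq_eq_norm_sq]
      push_cast
      field_simp
    rw [this, Complex.ofReal_re]

lemma unitVector_monotone (z w : ℂ) :
    0 ≤ (inner ℂ (z - w) (unitVector z - unitVector w)).re := by
  simp only [inner_sub_left, inner_sub_right, Complex.sub_re, re_inner_self_unitVector]
  linarith [re_inner_unitVector_le z w, re_inner_unitVector_le w z]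

lemma LipschitzOnWith.radial {p : ℝ → ℂ} {C : ℝ≥0} (hp : LipschitzOnWith C p (Ici 0))
    (p0 : p 0 = 0) : LipschitzWith (3 * C) fun z : ℂ => p ‖z‖ * unitVector z := by
  refine LipschitzWith.of_dist_le_mul fun z w => ?_
  rw [dist_eq_norm, dist_eq_norm]
  have h1 : ‖p ‖z‖ - p ‖w‖‖ ≤ C * ‖z - w‖ := by
    have := hp.dist_le_mul _ (norm_nonneg z) _ (norm_nonneg w)
    rw [dist_eq_norm, Real.dist_eq] at this
    exact this.trans (mul_le_mul_of_nonneg_left (abs_norm_sub_norm_le z w) C.2)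
  have h2 : ‖p ‖w‖‖ ≤ C * ‖w‖ := by
    have := hp.dist_le_mul _ (norm_nonneg w) _ (self_mem_Ici (a := (0 : ℝ)))
    simpa [p0, Real.dist_eq] using this
  have h3 : ‖w‖ * ‖unitVector z - unitVector w‖ ≤ 2 * ‖z - w‖ := by
    have e : (‖w‖ : ℂ) * (unitVector z - unitVector w) =
        (z - w) - ((‖z‖ - ‖w‖ : ℝ) : ℂ) * unitVector z := by
      push_cast
      linear_combination norm_mul_unitVector z - norm_mul_unitVector w
    have e' := congrArg norm e
    rw [norm_mul, Complex.norm_real, norm_norm] at e'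
    rw [e']
    refine (_root_.norm_sub_le _ _).trans ?_
    rw [norm_mul, Complex.norm_real, two_mul]
    gcongr
    exact (mul_le_of_le_one_right (norm_nonneg _) (norm_unitVector_le z)).trans
      (abs_norm_sub_norm_le z w)
  calc ‖p ‖z‖ * unitVector z - p ‖w‖ * unitVector w‖
      = ‖(p ‖z‖ - p ‖w‖) * unitVector z + p ‖w‖ * (unitVector z - unitVector w)‖ := by ring_nf
    _ ≤ ‖p ‖z‖ - p ‖w‖‖ * ‖unitVector z‖ + ‖p ‖w‖‖ * ‖unitVector z - unitVector w‖ := by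
        refine (_root_.norm_add_le _ _).trans ?_
        rw [norm_mul, norm_mul]
    _ ≤ C * ‖z - w‖ * 1 + C * ‖w‖ * ‖unitVector z - unitVector w‖ := by
        gcongr
        exact norm_unitVector_le z
    _ ≤ C * ‖z - w‖ + C * (2 * ‖z - w‖) := by
        rw [mul_one, mul_assoc]
        gcongr
    _ = ↑(3 * C) * ‖z - w‖ := by push_cast; ring

/-- The part `(|z| ζ(|z| + 1) - 1) z / |z|` of the nonlinearity left after its jump at `0`,
written with the entire function `riemannZeta₁ s = (s - 1) ζ(s)`. -/
noncomputable def zetaLipschitzPart (z : ℂ) : ℂ :=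
  (riemannZeta₁ ((‖z‖ : ℂ) + 1) - 1) * unitVector z

@[simp] lemma zetaLipschitzPart_zero : zetaLipschitzPart 0 = 0 := by simp [zetaLipschitzPart]

lemma exists_lipschitzWith_zetaLipschitzPart : ∃ C : ℝ≥0, LipschitzWith C zetaLipschitzPart := by
  obtain ⟨C, hC⟩ := exists_lipschitzOnWith_riemannZeta₁
  have h : LipschitzOnWith C (fun s : ℝ => riemannZeta₁ ((s : ℂ) + 1) - 1) (Ici 0) :=
    LipschitzOnWith.of_dist_le_mul fun s hs t ht => by
      rw [dist_sub_right]
      exact hC.dist_le_mul s hs t ht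
  exact ⟨3 * C, h.radial (by simp)⟩

/-- The nonlinearity splits as `z ζ(|z| + 1) = z / |z| + Lipschitz`: the pole of `ζ` at `1` with
residue `1` produces the monotone singular term. -/
lemma zetaNonlinearity_eq (z : ℂ) :
    zetaNonlinearity z = unitVector z + zetaLipschitzPart z := by
  rcases eq_or_ne z 0 with rfl | hz
  · simp [zetaNonlinearity]
  · rw [zetaLipschitzPart, riemannZeta₁_ofReal_add_one (norm_ne_zero_iff.2 hz), zetaNonlinearity]
    linear_combination (-riemannZeta ((‖z‖ : ℂ) + 1)) * norm_mul_unitVector z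

/-! ### Primitives of bounded vector-valued functions -/

section Primitive

variable {E : Type*} [NormedAddCommGroup E] [NormedSpace ℝ E]

lemma intervalIntegrable_of_ae_norm_le {E : Type*} [NormedAddCommGroup E] {g : ℝ → E}
    (hg : AEStronglyMeasurable g volume) {C : ℝ}
    (hC : ∀ᵐ t, ‖g t‖ ≤ C) (a b : ℝ) : IntervalIntegrable g volume a b :=
  intervalIntegrable_iff.2 ((((memLp_top_of_bound hg C hC).locallyIntegrable
    le_top).integrableOn_isCompact isCompact_uIcc).mono_set uIoc_subset_uIcc)

lemma lipschitzWith_primitive {g : ℝ → E} (hg : AEStronglyMeasurable g volume) {C : ℝ}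
    (hC : ∀ᵐ t, ‖g t‖ ≤ C) : LipschitzWith C.toNNReal fun t => ∫ s in (0 : ℝ)..t, g s := by
  refine LipschitzWith.of_dist_le_mul fun a b => ?_
  rw [dist_comm, dist_eq_norm, intervalIntegral.integral_interval_sub_left
    (intervalIntegrable_of_ae_norm_le hg hC _ _) (intervalIntegrable_of_ae_norm_le hg hC _ _),
    dist_comm, Real.dist_eq]
  refine intervalIntegral.norm_integral_le_of_norm_le_const_ae ?_
  filter_upwards [hC] with t ht _ using ht.trans (Real.le_coe_toNNReal C)

variable [CompleteSpace E]

/-- The fundamental theorem of calculus for a vector-valued absolutely continuous function with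
an almost everywhere derivative that is essentially bounded. -/
lemma AbsolutelyContinuousOnInterval.integral_eq_sub_of_ae_hasDerivAt {f f' : ℝ → E} {a b : ℝ}
    (hf : AbsolutelyContinuousOnInterval f a b) (hf' : AEStronglyMeasurable f' volume) {C : ℝ}
    (hC : ∀ᵐ t, ‖f' t‖ ≤ C) (hder : ∀ᵐ t, t ∈ uIcc a b → HasDerivAt f (f' t) t) :
    ∫ t in a..b, f' t = f b - f a := by
  have hprim := (lipschitzWith_primitive hf' hC).lipschitzOnWith (s := uIcc a b)
    |>.absolutelyContinuousOnInterval
  have hloc : LocallyIntegrable f' volume := (memLp_top_of_bound hf' C hC).locallyIntegrable le_top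
  obtain ⟨c, hc⟩ := (hf.fun_sub hprim).const_of_ae_hasDerivAt_zero (by
    filter_upwards [hder, _root_.LocallyIntegrable.ae_hasDerivAt_integral hloc] with t h1 h2 h3
    simpa using (h1 h3).fun_sub (h2 0))
  have ha := hc a left_mem_uIcc
  have hb := hc b right_mem_uIcc
  rw [← intervalIntegral.integral_interval_sub_left
    (intervalIntegrable_of_ae_norm_le hf' hC 0 b) (intervalIntegrable_of_ae_norm_le hf' hC 0 a)]
  rw [← ha] at hb
  rw [← sub_eq_zero] at hb ⊢
  rw [← neg_eq_zero, ← hb]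
  abel

/-- A compactly supported smooth function is, on `[0, ∞)`, the derivative of another one. -/
lemma exists_contDiff_deriv_eq {η : ℝ → ℝ} (hη : ContDiff ℝ ∞ η) (hηc : HasCompactSupport η) :
    ∃ (θ : ℝ → ℝ) (r : ℝ), ContDiff ℝ ∞ θ ∧ HasCompactSupport θ ∧ 0 ≤ r ∧
      (∀ t, 0 ≤ t → HasDerivAt θ (η t) t) ∧ ∀ t, r ≤ t → θ t = 0 ∧ η t = 0 := by
  obtain ⟨r, hr0, hr⟩ := hηc.isCompact.isBounded.subset_closedBall_lt 0 0
  have hη0 : ∀ t, r < t → η t = 0 := fun t ht => by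
    by_contra h
    have := hr (subset_tsupport _ h)
    rw [Metric.mem_closedBall, dist_zero_right, Real.norm_eq_abs] at this
    linarith [le_abs_self t]
  set Θ : ℝ → ℝ := fun t => ∫ s in (r + 1)..t, η s with hΘ
  have hΘd : ∀ t, HasDerivAt Θ (η t) t := fun t =>
    intervalIntegral.integral_hasDerivAt_right (hη.continuous.intervalIntegrable _ _)
      (hη.continuous.stronglyMeasurableAtFilter _ _) hη.continuous.continuousAt
  have hΘc : ContDiff ℝ ∞ Θ := by
    refine contDiff_infty_iff_deriv.2 ⟨fun t => (hΘd t).differentiableAt, ?_⟩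
    rwa [show deriv Θ = η from funext fun t => (hΘd t).deriv]
  have hΘ0 : ∀ t, r < t → Θ t = 0 := fun t ht => by
    refine (intervalIntegral.integral_congr (g := fun _ => 0) fun s hs => hη0 s ?_).trans (by simp)
    have := hs.1
    rcases le_total (r + 1) t with h | h
    · rw [min_eq_left h] at this
      linarith
    · rw [min_eq_right h] at this
      linarith
  -- the cut-off `χ` is `0` for `t ≤ -2` and `1` for `t ≥ -1`
  set χ : ℝ → ℝ := fun t => Real.smoothTransition (t + 2) with hχ
  have hχc : ContDiff ℝ ∞ χ := Real.smoothTransition.contDiff.comp (contDiff_id.add contDiff_const)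
  refine ⟨fun t => χ t * Θ t, r + 1, hχc.mul hΘc, ?_, by linarith, fun t ht => ?_, fun t ht =>
    ⟨?_, hη0 t (by linarith)⟩⟩
  · refine HasCompactSupport.of_support_subset_isCompact (isCompact_Icc (a := (-2 : ℝ)) (b := r))
      fun t ht => ⟨?_, ?_⟩
    · by_contra h
      exact ht (by simp [hχ, Real.smoothTransition.zero_of_nonpos (by linarith : t + 2 ≤ 0)])
    · by_contra h
      exact ht (by simp [hΘ0 t (by linarith)])
  · refine (hΘd t).congr_of_eventuallyEq ?_
    filter_upwards [lt_mem_nhds (by linarith : -1 < t)] with s hs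
    simp [hχ, Real.smoothTransition.one_of_one_le (by linarith : 1 ≤ s + 2)]
  · simp [hΘ0 t (by linarith)]

/-- If `h' = g` in the sense of distributions on `[0, ∞)`, with `h(0) = 0` encoded by test
functions that need not vanish at `0`, then `h` is the primitive of `g`. -/
lemma ae_eq_primitive_of_weak_deriv {h g : ℝ → E} (hh : AEStronglyMeasurable h volume)
    (hg : AEStronglyMeasurable g volume) {B C : ℝ} (hB : ∀ᵐ t, ‖h t‖ ≤ B)
    (hC : ∀ᵐ t, ‖g t‖ ≤ C)
    (hw : ∀ θ : ℝ → ℝ, ContDiff ℝ ∞ θ → HasCompactSupport θ →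
      ∫ t in Ici (0 : ℝ), (deriv θ t • h t + θ t • g t) = 0) :
    ∀ᵐ t ∂(volume.restrict (Ici (0 : ℝ))), h t = ∫ s in (0 : ℝ)..t, g s := by
  set y : ℝ → E := fun t => ∫ s in (0 : ℝ)..t, g s with hy
  have hyL := lipschitzWith_primitive hg hC
  have hhl : LocallyIntegrable h volume := (memLp_top_of_bound hh B hB).locallyIntegrable le_top
  have hgl : LocallyIntegrable g volume := (memLp_top_of_bound hg C hC).locallyIntegrable le_top
  have hyl : LocallyIntegrable y volume := hyL.continuous.locallyIntegrable
  have hloc : LocallyIntegrable (fun t => h t - y t) (volume.restrict (Ici (0 : ℝ))) :=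
    fun x => (hhl.sub hyl x).mono_measure Measure.restrict_le_self
  suffices H : ∀ η : ℝ → ℝ, ContDiff ℝ ∞ η → HasCompactSupport η →
      ∫ t in Ici (0 : ℝ), η t • (h t - y t) = 0 by
    filter_upwards [ae_eq_zero_of_integral_contDiff_smul_eq_zero hloc H] with t ht
    exact sub_eq_zero.1 ht
  intro η hη hηc
  obtain ⟨θ, r, hθ, hθc, hr, hd, h0⟩ := exists_contDiff_deriv_eq hη hηc
  have hint : ∀ {φ : ℝ → ℝ} {f : ℝ → E}, ContDiff ℝ ∞ φ → HasCompactSupport φ →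
      LocallyIntegrable f volume → Integrable (fun t => φ t • f t) (volume.restrict (Ici (0 : ℝ))) :=
    fun hφ hφc hf => (hf.integrable_smul_left_of_hasCompactSupport hφ.continuous hφc).restrict
  -- integration by parts of `θ • y` over `[0, r]`
  have hparts : ∫ t in Ici (0 : ℝ), (η t • y t + θ t • g t) = 0 := by
    have hθL : AbsolutelyContinuousOnInterval θ 0 r :=
      (hθ.of_le (by simp)).contDiffOn.absolutelyContinuousOnInterval
    have hac := hθL.smul
      (hyL.lipschitzOnWith (s := uIcc 0 r)).absolutelyContinuousOnInterval
    have key : ∫ t in (0 : ℝ)..r, (η t • y t + θ t • g t) = 0 := by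
      -- outside `[0, r]` the integrand is replaced by `0` to make it bounded
      have hbd : ∃ D : ℝ, ∀ᵐ t, ‖(Icc 0 r).indicator (fun t => η t • y t + θ t • g t) t‖ ≤ D := by
        obtain ⟨D1, hD1⟩ := (isCompact_Icc (a := (0 : ℝ)) (b := r)).exists_bound_of_continuousOn
          (hη.continuous.smul hyL.continuous).continuousOn
        obtain ⟨D2, hD2⟩ := (isCompact_Icc (a := (0 : ℝ)) (b := r)).exists_bound_of_continuousOn
          hθ.continuous.continuousOn
        refine ⟨|D1| + |D2| * |C|, ?_⟩
        filter_upwards [hC] with t ht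
        by_cases htr : t ∈ Icc 0 r
        · rw [indicator_of_mem htr]
          refine (norm_add_le _ _).trans ?_
          rw [norm_smul (θ t)]
          gcongr
          · exact (hD1 t htr).trans (le_abs_self _)
          · exact (hD2 t htr).trans (le_abs_self _)
          · exact ht.trans (le_abs_self _)
        · rw [indicator_of_notMem htr]
          simp only [norm_zero]
          positivity
      obtain ⟨D, hD⟩ := hbd
      have hftc := hac.integral_eq_sub_of_ae_hasDerivAt
        (((hη.continuous.smul hyL.continuous).aestronglyMeasurable.add
          (hθ.continuous.aestronglyMeasurable.smul hg)).indicator measurableSet_Icc) hD (by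
          filter_upwards [_root_.LocallyIntegrable.ae_hasDerivAt_integral hgl] with t ht htr
          rw [uIcc_of_le hr] at htr
          refine ((hd t htr.1).smul (ht 0)).congr_deriv ?_
          rw [indicator_of_mem htr]
          simp [add_comm])
      have : ∫ t in (0 : ℝ)..r, (η t • y t + θ t • g t) = ∫ t in (0 : ℝ)..r,
          (Icc 0 r).indicator ((fun t => η t • y t) + (θ • g)) t :=
        intervalIntegral.integral_congr fun t ht => by
          rw [uIcc_of_le hr] at ht
          rw [indicator_of_mem ht]
          rfl
      rw [this]
      refine hftc.trans ?_
      simp [(h0 r le_rfl).1]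
    rw [intervalIntegral.integral_of_le hr] at key
    rw [integral_Ici_eq_integral_Ioi, ← key]
    refine setIntegral_eq_of_subset_of_forall_sdiff_eq_zero measurableSet_Ioi
      (fun t ht => ht.1) fun t ht => ?_
    have : r < t := by
      by_contra hle
      exact ht.2 ⟨ht.1, not_lt.1 hle⟩
    simp [(h0 t this.le).1, (h0 t this.le).2]
  have hweak := hw θ hθ hθc
  have hderiv : ∫ t in Ici (0 : ℝ), (deriv θ t • h t + θ t • g t) =
      ∫ t in Ici (0 : ℝ), (η t • h t + θ t • g t) :=
    setIntegral_congr_fun measurableSet_Ici fun t ht => by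
      rw [(hd t ht).deriv]
  rw [hderiv, integral_add (hint hη hηc hhl) (hint hθ hθc hgl)] at hweak
  rw [integral_add (hint hη hηc hyl) (hint hθ hθc hgl)] at hparts
  simp only [smul_sub]
  rw [integral_sub (hint hη hηc hhl) (hint hη hηc hyl)]
  exact sub_eq_zero.2 (add_right_cancel (hweak.trans hparts.symm))

end Primitive

/-- `⟨R y, y⟩' = 2 Re ⟨R y, y'⟩` in integrated form, for a symmetric bounded operator `R` and a
primitive `y` of a bounded function. -/
lemma re_inner_primitive_eq {V : Type*} [NormedAddCommGroup V] [InnerProductSpace ℂ V]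
    [CompleteSpace V] (R : V →L[ℂ] V) (hR : ∀ x z, inner ℂ (R x) z = inner ℂ x (R z))
    {g : ℝ → V} (hg : AEStronglyMeasurable g volume) {C : ℝ} (hC : ∀ᵐ t, ‖g t‖ ≤ C)
    {b : ℝ} (hb : 0 ≤ b) :
    (inner ℂ (R (∫ s in (0 : ℝ)..b, g s)) (∫ s in (0 : ℝ)..b, g s)).re =
      ∫ t in (0 : ℝ)..b, 2 * (inner ℂ (R (∫ s in (0 : ℝ)..t, g s)) (g t)).re := by
  set y : ℝ → V := fun t => ∫ s in (0 : ℝ)..t, g s with hy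
  have hyL := lipschitzWith_primitive hg hC
  have hgl : LocallyIntegrable g volume := (memLp_top_of_bound hg C hC).locallyIntegrable le_top
  have hsymm : ∀ x z : V, (inner ℂ (R x) z).re = (inner ℂ (R z) x).re := fun x z => by
    rw [hR, ← inner_conj_symm, Complex.conj_re]
  have hCn : ∀ᵐ t, ‖g t‖ ≤ |C| := by
    filter_upwards [hC] with t ht using ht.trans (le_abs_self _)
  -- only `[0, b]` matters, and there `‖y‖ ≤ |C| b`
  have hybd : ∀ t ∈ Icc 0 b, ‖y t‖ ≤ |C| * b := fun t ht => by
    have := intervalIntegral.norm_integral_le_of_norm_le_const_ae (a := 0) (b := t)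
      (f := g) (C := |C|) (by filter_upwards [hCn] with s hs _ using hs)
    rw [sub_zero, abs_of_nonneg ht.1] at this
    exact this.trans (mul_le_mul_of_nonneg_left ht.2 (abs_nonneg _))
  have hac : AbsolutelyContinuousOnInterval (fun t => (inner ℂ (R (y t)) (y t)).re) 0 b := by
    refine LipschitzOnWith.absolutelyContinuousOnInterval
      (K := (2 * (‖R‖ * (|C| * b)) * C.toNNReal).toNNReal)
      (LipschitzOnWith.of_dist_le_mul fun s hs t ht => ?_)
    rw [uIcc_of_le hb] at hs ht
    rw [Real.coe_toNNReal _ (by positivity), Real.dist_eq]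
    have e : (inner ℂ (R (y s)) (y s)).re - (inner ℂ (R (y t)) (y t)).re =
        (inner ℂ (R (y s + y t)) (y s - y t)).re := by
      simp only [map_add, inner_add_left, inner_sub_right, Complex.add_re, Complex.sub_re]
      rw [hsymm (y t) (y s)]
      ring
    rw [e]
    have h1 := hyL.dist_le_mul s t
    rw [dist_eq_norm] at h1
    have h2 : ‖y s + y t‖ ≤ 2 * (|C| * b) := by
      refine (norm_add_le _ _).trans ?_
      linarith [hybd s hs, hybd t ht]
    calc |(inner ℂ (R (y s + y t)) (y s - y t)).re|
        ≤ ‖R (y s + y t)‖ * ‖y s - y t‖ :=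
          (Complex.abs_re_le_norm _).trans (norm_inner_le_norm _ _)
      _ ≤ (‖R‖ * (2 * (|C| * b))) * (C.toNNReal * dist s t) := by
          gcongr
          exact R.le_opNorm_of_le h2
      _ = 2 * (‖R‖ * (|C| * b)) * C.toNNReal * dist s t := by ring
  have hmeas : AEStronglyMeasurable (fun t => 2 * (inner ℂ (R (y t)) (g t)).re) volume := by
    have h1 : AEStronglyMeasurable (fun t => inner ℂ (R (y t)) (g t)) volume :=
      (R.continuous.comp hyL.continuous).aestronglyMeasurable.inner hg
    exact (Complex.continuous_re.comp_aestronglyMeasurable h1).const_mul 2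
  have hbd : ∀ᵐ t, ‖(Icc 0 b).indicator (fun t => 2 * (inner ℂ (R (y t)) (g t)).re) t‖ ≤
      2 * (‖R‖ * (|C| * b) * |C|) := by
    filter_upwards [hCn] with t ht
    by_cases htb : t ∈ Icc 0 b
    · rw [indicator_of_mem htb, norm_mul, Real.norm_two]
      gcongr
      refine (Complex.abs_re_le_norm _).trans ((norm_inner_le_norm _ _).trans ?_)
      gcongr
      exact R.le_opNorm_of_le (hybd t htb)
    · rw [indicator_of_notMem htb]
      simp only [norm_zero]
      positivity
  have hftc := hac.integral_eq_sub_of_ae_hasDerivAt (hmeas.indicator measurableSet_Icc) hbd (by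
    filter_upwards [_root_.LocallyIntegrable.ae_hasDerivAt_integral hgl] with t ht htb
    rw [uIcc_of_le hb] at htb
    rw [indicator_of_mem htb]
    have hRy : HasDerivAt (fun t => R (y t)) (R (g t)) t :=
      (R.restrictScalars ℝ).hasFDerivAt.comp_hasDerivAt t (ht 0)
    have h2 := Complex.reCLM.hasFDerivAt.comp_hasDerivAt t (hRy.inner ℂ (ht 0))
    refine h2.congr_deriv ?_
    change (inner ℂ (R (y t)) (g t) + inner ℂ (R (g t)) (y t)).re = _
    rw [Complex.add_re, hsymm (g t) (y t)]
    ring)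
  have hy0 : y 0 = 0 := by simp [hy]
  rw [hy0, map_zero, inner_zero_left, Complex.zero_re, sub_zero] at hftc
  rw [← hftc]
  refine intervalIntegral.integral_congr fun t ht => ?_
  rw [uIcc_of_le hb] at ht
  rw [indicator_of_mem ht]

/-- Grönwall's inequality for an essentially bounded function. -/
lemma ae_nonpos_of_le_integral {e : ℝ → ℝ} (he : AEStronglyMeasurable e volume) {B K : ℝ}
    (hB : ∀ᵐ t, |e t| ≤ B) (hK : 0 ≤ K)
    (h : ∀ᵐ t ∂(volume.restrict (Ici (0 : ℝ))), e t ≤ K * ∫ s in (0 : ℝ)..t, e s) :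
    ∀ᵐ t ∂(volume.restrict (Ici (0 : ℝ))), e t ≤ 0 := by
  rw [ae_restrict_iff' measurableSet_Ici] at h ⊢
  have hint : ∀ a b, IntervalIntegrable e volume a b := intervalIntegrable_of_ae_norm_le he hB
  have step : ∀ n : ℕ, ∀ᵐ t, t ∈ Ici (0 : ℝ) → e t ≤ B * ((K * t) ^ n / n.factorial) := by
    intro n
    induction n with
    | zero =>
      filter_upwards [hB] with t ht _
      simpa using (le_abs_self _).trans ht
    | succ n ih =>
      filter_upwards [h] with t ht ht0
      refine (ht ht0).trans ?_
      have hcont : Continuous fun s : ℝ => B * ((K * s) ^ n / n.factorial) := by fun_prop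
      have hle : ∫ s in (0 : ℝ)..t, e s ≤ ∫ s in (0 : ℝ)..t, B * ((K * s) ^ n / n.factorial) := by
        refine intervalIntegral.integral_mono_ae_restrict ht0 (hint _ _)
          (hcont.intervalIntegrable _ _) ?_
        refine (ae_restrict_iff' measurableSet_Icc).2 ?_
        filter_upwards [ih] with s hs hst using hs hst.1
      refine (mul_le_mul_of_nonneg_left hle hK).trans (le_of_eq ?_)
      simp only [mul_pow, mul_div_assoc, intervalIntegral.integral_const_mul,
        intervalIntegral.integral_div, integral_pow, Nat.factorial_succ]
      push_cast
      field_simp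
      ring
  filter_upwards [ae_all_iff.2 step] with t ht ht0
  have hlim := (FloorSemiring.tendsto_pow_div_factorial_atTop (K * t)).const_mul B
  rw [mul_zero] at hlim
  exact ge_of_tendsto' hlim fun n => ht n ht0

/-! ### The defect operator of a contraction -/

section Hilbert

variable {V H : Type*} [NormedAddCommGroup V] [InnerProductSpace ℂ V] [CompleteSpace V]
  [NormedAddCommGroup H] [InnerProductSpace ℂ H] [CompleteSpace H]

/-- The defect operator `1 - J† J` of `J : V → H`. When `V = H¹`, `H = L²` and `J` is the
inclusion, it represents the Dirichlet form in the `H¹` inner product. -/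
noncomputable def defectOp (J : V →L[ℂ] H) : V →L[ℂ] V :=
  1 - ContinuousLinearMap.adjoint J ∘L J

variable (J : V →L[ℂ] H)

lemma defectOp_apply (x : V) : defectOp J x = x - ContinuousLinearMap.adjoint J (J x) := rfl

lemma isSelfAdjoint_defectOp : IsSelfAdjoint (defectOp J) :=
  (IsSelfAdjoint.one _).sub (ContinuousLinearMap.isPositive_adjoint_comp_self J).isSelfAdjoint

lemma inner_adjoint_comp_self (x z : V) :
    inner ℂ x (ContinuousLinearMap.adjoint J (J z)) = inner ℂ (J x) (J z) :=
  ContinuousLinearMap.adjoint_inner_right J x (J z)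

variable {J}

lemma norm_adjoint_le_of_contraction (hJ : ‖J‖ ≤ 1) (x : H) :
    ‖ContinuousLinearMap.adjoint J x‖ ≤ ‖x‖ := by
  refine ((ContinuousLinearMap.adjoint J).le_opNorm x).trans ?_
  rw [LinearIsometryEquiv.norm_map]
  exact mul_le_of_le_one_left (norm_nonneg _) hJ

omit [CompleteSpace V] [CompleteSpace H] in
lemma norm_apply_le_of_contraction (hJ : ‖J‖ ≤ 1) (x : V) : ‖J x‖ ≤ ‖x‖ :=
  (J.le_opNorm x).trans (mul_le_of_le_one_left (norm_nonneg _) hJ)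

lemma norm_defectOp_sq_le (hJ : ‖J‖ ≤ 1) (x : V) :
    ‖defectOp J x‖ ^ 2 ≤ ‖x‖ ^ 2 - ‖J x‖ ^ 2 := by
  rw [defectOp_apply, @norm_sub_sq ℂ, inner_adjoint_comp_self, inner_self_eq_norm_sq_to_K]
  have h1 : RCLike.re ((‖J x‖ : ℂ) ^ 2) = ‖J x‖ ^ 2 := by
    rw [← Complex.ofReal_pow]
    exact Complex.ofReal_re _
  have h2 : ‖ContinuousLinearMap.adjoint J (J x)‖ ^ 2 ≤ ‖J x‖ ^ 2 := by
    gcongr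
    exact norm_adjoint_le_of_contraction hJ _
  have h3 : RCLike.re (((RCLike.ofReal ‖J x‖ : ℂ)) ^ 2) = ‖J x‖ ^ 2 := h1
  rw [h3]
  linarith

lemma defectOp_pow_succ_apply (n : ℕ) (x : V) :
    (defectOp J ^ (n + 1)) x = defectOp J ((defectOp J ^ n) x) := by
  rw [pow_succ']
  rfl

lemma norm_defectOp_pow_le (hJ : ‖J‖ ≤ 1) (n : ℕ) (x : V) :
    ‖(defectOp J ^ n) x‖ ≤ ‖x‖ := by
  induction n with
  | zero => simp
  | succ n ih =>
    refine le_trans ?_ ih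
    rw [defectOp_pow_succ_apply]
    refine le_of_sq_le_sq ((norm_defectOp_sq_le hJ _).trans ?_) (norm_nonneg _)
    linarith [sq_nonneg ‖J ((defectOp J ^ n) x)‖]

/-- The powers of `A = 1 - J† J` tend to `0` after composition with `J`, since
`‖J Aⁿ x‖² ≤ ‖Aⁿ x‖² - ‖Aⁿ⁺¹ x‖²` telescopes. -/
lemma tendsto_apply_defectOp_pow (hJ : ‖J‖ ≤ 1) (x : V) :
    Tendsto (fun n : ℕ => J ((defectOp J ^ n) x)) atTop (𝓝 0) := by
  set c : ℕ → ℝ := fun n => ‖(defectOp J ^ n) x‖ ^ 2 with hc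
  have hle : ∀ n, ‖J ((defectOp J ^ n) x)‖ ^ 2 ≤ c n - c (n + 1) := fun n => by
    have := norm_defectOp_sq_le hJ ((defectOp J ^ n) x)
    rw [hc]
    simp only [defectOp_pow_succ_apply]
    linarith
  have hanti : Antitone c := antitone_nat_of_succ_le fun n => by
    linarith [hle n, sq_nonneg ‖J ((defectOp J ^ n) x)‖]
  have hlim := tendsto_atTop_ciInf hanti ⟨0, by rintro _ ⟨n, rfl⟩; exact sq_nonneg _⟩
  have hdiff := hlim.sub (hlim.comp (tendsto_add_atTop_nat 1))
  rw [sub_self] at hdiff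
  have hsq := squeeze_zero (fun n => sq_nonneg _) hle hdiff
  rw [tendsto_zero_iff_norm_tendsto_zero]
  have := hsq.sqrt
  simpa using this

/-- The geometric sum `∑_{k < n} (1 - J† J)ᵏ`, a bounded approximate inverse of `J† J`. -/
noncomputable def approxInverse (J : V →L[ℂ] H) (n : ℕ) : V →L[ℂ] V :=
  ∑ k ∈ Finset.range n, defectOp J ^ k

lemma approxInverse_symm (n : ℕ) (x z : V) :
    inner ℂ (approxInverse J n x) z = inner ℂ x (approxInverse J n z) := by
  have h : IsSelfAdjoint (approxInverse J n) :=
    isSelfAdjoint_sum _ fun k _ => (isSelfAdjoint_defectOp J).pow k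
  exact h.isSymmetric x z

lemma approxInverse_adjoint_apply (n : ℕ) (x : V) :
    approxInverse J n (ContinuousLinearMap.adjoint J (J x)) = x - (defectOp J ^ n) x := by
  have h : approxInverse J n ((1 - defectOp J) x) = (1 - defectOp J ^ n : V →L[ℂ] V) x :=
    congrArg (fun S : V →L[ℂ] V => S x) (geom_sum_mul_neg (defectOp J) n)
  have e : (1 - defectOp J) x = ContinuousLinearMap.adjoint J (J x) := by
    simp [defectOp_apply]
  rw [e] at h
  exact h

/-- The pairing of `(1 - Aⁿ) x` with `A x`, where `A = 1 - J† J`, is real: this removes the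
Laplacian from the energy identity. -/
lemma im_inner_defectOp_eq_zero (n : ℕ) (x : V) :
    (inner ℂ (x - (defectOp J ^ n) x) (defectOp J x)).im = 0 := by
  set S : V →L[ℂ] V := defectOp J * (1 - defectOp J ^ n)
  have hS : IsSelfAdjoint S := by
    refine ((isSelfAdjoint_defectOp J).commute_iff
      ((IsSelfAdjoint.one _).sub ((isSelfAdjoint_defectOp J).pow n))).1 ?_
    exact (Commute.one_right _).sub_right (Commute.self_pow _ _)
  have e : inner ℂ (x - (defectOp J ^ n) x) (defectOp J x) = inner ℂ (S x) x :=
    ((isSelfAdjoint_defectOp J).isSymmetric _ x).symm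
  rw [e, ← Complex.conj_eq_iff_im, inner_conj_symm]
  exact (hS.isSymmetric x x).symm

/-! ### The energy identity and uniqueness in an abstract Hilbert setting -/

variable {w : ℝ → V} {G : ℝ → H} {B D lam : ℝ}

/-- The right-hand side of `(J† J w)' = -i (1 - J† J) w - lam J† G`. -/
noncomputable def evolutionRHS (J : V →L[ℂ] H) (lam : ℝ) (w : ℝ → V) (G : ℝ → H) (t : ℝ) : V :=
  -(Complex.I • defectOp J (w t)) - (lam : ℂ) • ContinuousLinearMap.adjoint J (G t)

lemma aestronglyMeasurable_evolutionRHS {ν : Measure ℝ} (hw : AEStronglyMeasurable w ν)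
    (hG : AEStronglyMeasurable G ν) :
    AEStronglyMeasurable (evolutionRHS J lam w G) ν :=
  (((defectOp J).continuous.comp_aestronglyMeasurable hw).const_smul Complex.I).neg.sub
    (((ContinuousLinearMap.adjoint J).continuous.comp_aestronglyMeasurable hG).const_smul (lam : ℂ))

lemma norm_evolutionRHS_le {ν : Measure ℝ} (hJ : ‖J‖ ≤ 1) (hlam : 0 ≤ lam)
    (hB : ∀ᵐ t ∂ν, ‖w t‖ ≤ B) (hD : ∀ᵐ t ∂ν, ‖G t‖ ≤ D) : ∀ᵐ t ∂ν, ‖evolutionRHS J lam w G t‖ ≤ B + lam * D := by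
  filter_upwards [hB, hD] with t h1 h2
  refine (norm_sub_le _ _).trans ?_
  rw [norm_neg, norm_smul, norm_smul, Complex.norm_I, one_mul, Complex.norm_real,
    Real.norm_of_nonneg hlam]
  gcongr
  · simpa using (norm_defectOp_pow_le hJ 1 (w t)).trans h1
  · exact (norm_adjoint_le_of_contraction hJ _).trans h2

lemma re_inner_evolutionRHS (n : ℕ) (t : ℝ) :
    (inner ℂ (w t - (defectOp J ^ n) (w t)) (evolutionRHS J lam w G t)).re =
      -lam * (inner ℂ (J (w t - (defectOp J ^ n) (w t))) (G t)).re := by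
  rw [evolutionRHS, inner_sub_right, inner_neg_right, inner_smul_right, inner_smul_right,
    ContinuousLinearMap.adjoint_inner_right, Complex.sub_re, Complex.neg_re, Complex.I_mul_re,
    im_inner_defectOp_eq_zero, Complex.re_ofReal_mul]
  ring

/-- The energy identity `‖J w(t)‖² = -2 lam ∫₀ᵗ Re ⟨J w, G⟩`. As `w` is only measurable with
values in `V`, the identity is derived for the Lipschitz functions `⟨Rₙ y, y⟩`, where `y = J† J w`
and `Rₙ` is the approximate inverse of `J† J`, and passes to the limit `n → ∞`. -/
lemma energy_identity (hJ : ‖J‖ ≤ 1) (hlam : 0 ≤ lam) (hw : AEStronglyMeasurable w volume)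
    (hG : AEStronglyMeasurable G volume) (hB : ∀ᵐ t, ‖w t‖ ≤ B) (hD : ∀ᵐ t, ‖G t‖ ≤ D)
    (hy : ∀ᵐ t ∂(volume.restrict (Ici (0 : ℝ))), ContinuousLinearMap.adjoint J (J (w t)) =
      ∫ s in (0 : ℝ)..t, evolutionRHS J lam w G s) :
    ∀ᵐ t ∂(volume.restrict (Ici (0 : ℝ))),
      ‖J (w t)‖ ^ 2 = ∫ s in (0 : ℝ)..t, -(2 * lam) * (inner ℂ (J (w s)) (G s)).re := by
  have hmeas := aestronglyMeasurable_evolutionRHS (J := J) (lam := lam) hw hG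
  have hbd := norm_evolutionRHS_le hJ hlam hB hD
  have hy' := (ae_restrict_iff' measurableSet_Ici).1 hy
  rw [ae_restrict_iff' measurableSet_Ici]
  filter_upwards [hy'] with t hyt ht
  have ht0 : (0 : ℝ) ≤ t := ht
  have happrox : ∀ n : ℕ, (inner ℂ (J (w t - (defectOp J ^ n) (w t))) (J (w t))).re =
      ∫ s in (0 : ℝ)..t, -(2 * lam) * (inner ℂ (J (w s - (defectOp J ^ n) (w s))) (G s)).re := by
    intro n
    have h := re_inner_primitive_eq (approxInverse J n) (approxInverse_symm n) hmeas hbd ht0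
    rw [← hyt ht, approxInverse_adjoint_apply, inner_adjoint_comp_self] at h
    rw [h]
    refine intervalIntegral.integral_congr_ae ?_
    filter_upwards [hy'] with s hys hs
    rw [uIoc_of_le ht0] at hs
    rw [← hys hs.1.le, approxInverse_adjoint_apply, re_inner_evolutionRHS]
    ring
  have hJlim : ∀ x : V, Tendsto (fun n : ℕ => J (x - (defectOp J ^ n) x)) atTop (𝓝 (J x)) :=
    fun x => by
      have := (tendsto_const_nhds (x := J x)).sub (tendsto_apply_defectOp_pow hJ x)
      simpa using this
  have hleft : Tendsto (fun n : ℕ => (inner ℂ (J (w t - (defectOp J ^ n) (w t))) (J (w t))).re)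
      atTop (𝓝 (‖J (w t)‖ ^ 2)) := by
    have h := (Complex.continuous_re.tendsto _).comp
      ((hJlim (w t)).inner (tendsto_const_nhds (x := J (w t))) (𝕜 := ℂ))
    have e : (inner ℂ (J (w t)) (J (w t))).re = ‖J (w t)‖ ^ 2 :=
      inner_self_eq_norm_sq (𝕜 := ℂ) (J (w t))
    rwa [e] at h
  refine tendsto_nhds_unique hleft ?_
  simp only [happrox]
  refine intervalIntegral.tendsto_integral_filter_of_dominated_convergence
    (fun _ => 2 * lam * (2 * B * D)) (.of_forall fun n => ?_) (.of_forall fun n => ?_)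
    intervalIntegrable_const (.of_forall fun s _ => ?_)
  · refine AEStronglyMeasurable.restrict ?_
    refine (Complex.continuous_re.comp_aestronglyMeasurable ?_).const_mul _
    exact (J.continuous.comp_aestronglyMeasurable
      (hw.sub ((defectOp J ^ n).continuous.comp_aestronglyMeasurable hw))).inner hG
  · filter_upwards [hB, hD] with s h1 h2 _
    rw [norm_mul, norm_neg, Real.norm_of_nonneg (by positivity : 0 ≤ 2 * lam)]
    gcongr
    refine (Complex.abs_re_le_norm _).trans ((norm_inner_le_norm _ _).trans ?_)
    have h3 : ‖J (w s - (defectOp J ^ n) (w s))‖ ≤ 2 * B := by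
      refine (norm_apply_le_of_contraction hJ _).trans ((norm_sub_le _ _).trans ?_)
      linarith [norm_defectOp_pow_le hJ n (w s)]
    exact mul_le_mul h3 h2 (norm_nonneg _) ((norm_nonneg _).trans h3)
  · have h := (Complex.continuous_re.tendsto _).comp
      ((hJlim (w s)).inner (tendsto_const_nhds (x := G s)) (𝕜 := ℂ))
    exact h.const_mul _

/-- Uniqueness for the abstract weak equation: if `J† J w` starts from `0` and has the weak
derivative `-i (1 - J† J) w - lam J† G`, where `G` is monotone relative to `J w` up to a multiple
of `‖J w‖²`, then `w = 0`. The energy identity only gives `J w = 0`; the equation itself then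
reads `-i w = 0`, so that `J` need not be injective. -/
theorem ae_eq_zero_of_weak_evolution (hJ : ‖J‖ ≤ 1) (hlam : 0 ≤ lam)
    (hw : AEStronglyMeasurable w volume) (hG : AEStronglyMeasurable G volume)
    (hB : ∀ᵐ t, ‖w t‖ ≤ B) (hD : ∀ᵐ t, ‖G t‖ ≤ D) {K : ℝ} (hK : 0 ≤ K)
    (hmono : ∀ t, -(K * ‖J (w t)‖ ^ 2) ≤ (inner ℂ (J (w t)) (G t)).re)
    (hzero : ∀ t, J (w t) = 0 → G t = 0)
    (hweak : ∀ θ : ℝ → ℝ, ContDiff ℝ ∞ θ → HasCompactSupport θ → ∫ t in Ici (0 : ℝ),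
      (deriv θ t • ContinuousLinearMap.adjoint J (J (w t)) + θ t • evolutionRHS J lam w G t) = 0) :
    ∀ᵐ t ∂(volume.restrict (Ici (0 : ℝ))), w t = 0 := by
  have hJw : AEStronglyMeasurable (fun t => J (w t)) volume :=
    J.continuous.comp_aestronglyMeasurable hw
  have hy := ae_eq_primitive_of_weak_deriv
    ((ContinuousLinearMap.adjoint J).continuous.comp_aestronglyMeasurable hJw)
    (aestronglyMeasurable_evolutionRHS (J := J) (lam := lam) hw hG) (B := B)
    (by
      filter_upwards [hB] with t ht
      exact (norm_adjoint_le_of_contraction hJ _).trans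
        ((norm_apply_le_of_contraction hJ _).trans ht))
    (norm_evolutionRHS_le hJ hlam hB hD) hweak
  have hen := energy_identity hJ hlam hw hG hB hD hy
  have hsqm : AEStronglyMeasurable (fun t => ‖J (w t)‖ ^ 2) volume := hJw.norm.pow 2
  have hsqb : ∀ᵐ t, |‖J (w t)‖ ^ 2| ≤ B ^ 2 := by
    filter_upwards [hB] with t ht
    rw [abs_of_nonneg (sq_nonneg _)]
    gcongr
    exact (norm_apply_le_of_contraction hJ _).trans ht
  have hJ0 : ∀ᵐ t ∂(volume.restrict (Ici (0 : ℝ))), J (w t) = 0 := by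
    have hgr := ae_nonpos_of_le_integral hsqm hsqb (K := 2 * lam * K) (by positivity) (by
      filter_upwards [hen, ae_restrict_mem measurableSet_Ici] with t ht ht0
      rw [ht, ← intervalIntegral.integral_const_mul]
      refine intervalIntegral.integral_mono_on ht0 ?_
        ((intervalIntegrable_of_ae_norm_le hsqm hsqb _ _).const_mul _) fun s _ => ?_
      · refine (intervalIntegrable_of_ae_norm_le (C := B * D)
          (Complex.continuous_re.comp_aestronglyMeasurable (hJw.inner (𝕜 := ℂ) hG)) ?_ _ _).const_mul _
        filter_upwards [hB, hD] with s h1 h2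
        refine (Complex.abs_re_le_norm _).trans ((norm_inner_le_norm _ _).trans ?_)
        have h3 := (norm_apply_le_of_contraction hJ (w s)).trans h1
        exact mul_le_mul h3 h2 (norm_nonneg _) ((norm_nonneg _).trans h3)
      · have := mul_le_mul_of_nonneg_left (hmono s) (by positivity : 0 ≤ 2 * lam)
        linarith)
    filter_upwards [hgr] with t ht
    have : ‖J (w t)‖ = 0 := by nlinarith [sq_nonneg ‖J (w t)‖]
    exact norm_eq_zero.1 this
  -- with `J w = 0` and `G = 0` the weak equation says that `w` is orthogonal to all test functions
  have hloc : LocallyIntegrable w (volume.restrict (Ici (0 : ℝ))) := fun x =>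
    ((memLp_top_of_bound hw B hB).locallyIntegrable le_top x).mono_measure Measure.restrict_le_self
  refine ae_eq_zero_of_integral_contDiff_smul_eq_zero hloc fun θ hθ hθc => ?_
  have h := hweak θ hθ hθc
  have e : ∫ t in Ici (0 : ℝ), (deriv θ t • ContinuousLinearMap.adjoint J (J (w t)) +
      θ t • evolutionRHS J lam w G t) = ∫ t in Ici (0 : ℝ), (-Complex.I) • (θ t • w t) := by
    refine integral_congr_ae ?_
    filter_upwards [hJ0] with t ht
    rw [evolutionRHS, defectOp_apply, ht, hzero t ht]
    simp only [map_zero, smul_zero, sub_zero, zero_add, neg_smul, smul_neg]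
    rw [smul_comm]
  rw [e, integral_smul] at h
  exact (smul_eq_zero.1 h).resolve_left (by simp)

end Hilbert

/-! ### The superposition operator of the nonlinearity on `L²` -/

section Superposition

lemma measurable_unitVector : Measurable unitVector := by
  unfold unitVector
  fun_prop

/-- The Lipschitz map `z / (ε + |z|)`, with `ε = 1 / (n + 1)`, which approximates `z / |z|`. -/
noncomputable def approxUnitVector (n : ℕ) (z : ℂ) : ℂ := z / ((1 / (n + 1) + ‖z‖ : ℝ) : ℂ)

@[simp] lemma approxUnitVector_zero (n : ℕ) : approxUnitVector n 0 = 0 := by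
  simp [approxUnitVector]

lemma norm_approxUnitVector_le (n : ℕ) (z : ℂ) : ‖approxUnitVector n z‖ ≤ 1 := by
  have h : 0 < 1 / ((n : ℝ) + 1) := by positivity
  rw [approxUnitVector, norm_div, Complex.norm_real, Real.norm_of_nonneg (by positivity)]
  exact div_le_one_of_le₀ (by linarith) (by positivity)

lemma exists_lipschitzWith_approxUnitVector (n : ℕ) :
    ∃ C : ℝ≥0, LipschitzWith C (approxUnitVector n) := by
  refine ⟨2 * (n + 1), LipschitzWith.of_dist_le_mul fun z w => ?_⟩
  rw [dist_eq_norm, dist_eq_norm]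
  obtain ⟨ε, hε, hε0⟩ : ∃ ε : ℝ, ε = 1 / ((n : ℝ) + 1) ∧ 0 < ε := ⟨_, rfl, by positivity⟩
  have hz : 0 < ε + ‖z‖ := by positivity
  have hw : 0 < ε + ‖w‖ := by positivity
  have hz' : (ε + ‖z‖ : ℂ) ≠ 0 := by exact_mod_cast hz.ne'
  have hw' : (ε + ‖w‖ : ℂ) ≠ 0 := by exact_mod_cast hw.ne'
  have e : (ε + ‖z‖ : ℂ) * (approxUnitVector n z - approxUnitVector n w) =
      (z - w) + ((‖w‖ - ‖z‖ : ℝ) : ℂ) * approxUnitVector n w := by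
    simp only [approxUnitVector, ← hε]
    push_cast
    field_simp
    ring
  have e' := congrArg norm e
  rw [norm_mul, ← Complex.ofReal_add, Complex.norm_real, Real.norm_of_nonneg hz.le] at e'
  have h1 : (ε + ‖z‖) * ‖approxUnitVector n z - approxUnitVector n w‖ ≤ 2 * ‖z - w‖ := by
    rw [e']
    refine (norm_add_le _ _).trans ?_
    rw [norm_mul, Complex.norm_real, two_mul, norm_sub_rev z w]
    gcongr
    exact (mul_le_of_le_one_right (norm_nonneg _) (norm_approxUnitVector_le n w)).trans
      (abs_norm_sub_norm_le w z)
  have h2 : ε * ‖approxUnitVector n z - approxUnitVector n w‖ ≤ 2 * ‖z - w‖ :=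
    le_trans (by gcongr; linarith [norm_nonneg z]) h1
  have h3 : ((n : ℝ) + 1) * ε = 1 := by
    rw [hε]
    field_simp
  calc ‖approxUnitVector n z - approxUnitVector n w‖
      = (n + 1) * (ε * ‖approxUnitVector n z - approxUnitVector n w‖) := by
        rw [← mul_assoc, h3, one_mul]
    _ ≤ (n + 1) * (2 * ‖z - w‖) := by gcongr
    _ = ↑(2 * (n + 1) : ℝ≥0) * ‖z - w‖ := by push_cast; ring

lemma tendsto_approxUnitVector (z : ℂ) :
    Tendsto (fun n => approxUnitVector n z) atTop (𝓝 (unitVector z)) := by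
  rcases eq_or_ne z 0 with rfl | hz
  · simp
  · have h1 : Tendsto (fun n : ℕ => ((1 / ((n : ℝ) + 1) + ‖z‖ : ℝ) : ℂ)) atTop
        (𝓝 ((0 + ‖z‖ : ℝ) : ℂ)) := (Complex.continuous_ofReal.tendsto _).comp
      (tendsto_one_div_add_atTop_nhds_zero_nat.add_const _)
    rw [zero_add] at h1
    exact tendsto_const_nhds.div h1 (by simpa using hz)

variable {X : Type*} [MeasurableSpace X] {μ : Measure X} [IsFiniteMeasure μ]

lemma memLp_unitVector (f : Lp ℂ 2 μ) : MemLp (fun x => unitVector (f x)) 2 μ :=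
  MemLp.of_bound
    (measurable_unitVector.comp_aemeasurable (Lp.aestronglyMeasurable f).aemeasurable
      |>.aestronglyMeasurable) 1 (.of_forall fun _ => norm_unitVector_le _)

omit [IsFiniteMeasure μ] in
lemma LipschitzWith.compLp_eq_toLp {φ : ℂ → ℂ} {C : ℝ≥0} (hφ : LipschitzWith C φ) (h0 : φ 0 = 0)
    (f : Lp ℂ 2 μ) (hf : MemLp (fun x => φ (f x)) 2 μ) : hφ.compLp h0 f = hf.toLp _ :=
  Lp.ext ((hφ.coeFn_compLp h0 f).trans hf.coeFn_toLp.symm)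

omit [IsFiniteMeasure μ] in
lemma memLp_zetaLipschitzPart (f : Lp ℂ 2 μ) : MemLp (fun x => zetaLipschitzPart (f x)) 2 μ := by
  obtain ⟨C, hC⟩ := exists_lipschitzWith_zetaLipschitzPart
  exact hC.comp_memLp zetaLipschitzPart_zero (Lp.memLp f)

lemma memLp_zetaNonlinearity (f : Lp ℂ 2 μ) : MemLp (fun x => zetaNonlinearity (f x)) 2 μ := by
  simp only [zetaNonlinearity_eq]
  exact (memLp_unitVector f).add (memLp_zetaLipschitzPart f)

/-- The superposition operator `f ↦ f ζ(|f| + 1)` on `L²`. -/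
noncomputable def zetaSuperposition (f : Lp ℂ 2 μ) : Lp ℂ 2 μ :=
  (memLp_zetaNonlinearity f).toLp _

lemma coeFn_zetaSuperposition (f : Lp ℂ 2 μ) :
    zetaSuperposition f =ᵐ[μ] fun x => zetaNonlinearity (f x) :=
  (memLp_zetaNonlinearity f).coeFn_toLp

lemma zetaSuperposition_eq (f : Lp ℂ 2 μ) : zetaSuperposition f =
    (memLp_unitVector f).toLp _ + (memLp_zetaLipschitzPart f).toLp _ := by
  rw [← MemLp.toLp_add]
  exact MemLp.toLp_congr _ _ (.of_forall fun x => zetaNonlinearity_eq (f x))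

lemma tendsto_compLp_approxUnitVector {C : ℕ → ℝ≥0}
    (hC : ∀ n, LipschitzWith (C n) (approxUnitVector n)) (f : Lp ℂ 2 μ) :
    Tendsto (fun n => (hC n).compLp (approxUnitVector_zero n) f) atTop
      (𝓝 ((memLp_unitVector f).toLp _)) := by
  have hm : ∀ n, AEStronglyMeasurable (fun x => approxUnitVector n (f x)) μ := fun n =>
    (hC n).continuous.comp_aestronglyMeasurable (Lp.aestronglyMeasurable f)
  have hb : ∀ n, MemLp (fun x => approxUnitVector n (f x)) 2 μ := fun n =>
    MemLp.of_bound (hm n) 1 (.of_forall fun _ => norm_approxUnitVector_le _ _)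
  simp only [fun n => (hC n).compLp_eq_toLp (approxUnitVector_zero n) f (hb n)]
  refine (Lp.tendsto_Lp_iff_tendsto_eLpNorm'' _ hb _ (memLp_unitVector f)).2 ?_
  have hlim : ∀ x, Tendsto (fun n => approxUnitVector n (f x)) atTop (𝓝 (unitVector (f x))) :=
    fun x => tendsto_approxUnitVector _
  -- dominated convergence for `∫ |f_n - f|²`
  have hint : Tendsto (fun n => ∫⁻ x, ‖approxUnitVector n (f x) - unitVector (f x)‖ₑ ^ (2 : ℝ) ∂μ)
      atTop (𝓝 (∫⁻ _, 0 ∂μ)) := by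
    refine tendsto_lintegral_of_dominated_convergence' (fun _ => 2 ^ (2 : ℝ)) (fun n => ?_)
      (fun n => .of_forall fun x => ?_) ?_ (.of_forall fun x => ?_)
    · exact ((hm n).sub (memLp_unitVector f).1).enorm.pow_const _
    · beta_reduce
      gcongr
      rw [← ofReal_norm]
      refine (ENNReal.ofReal_le_ofReal (q := 2) ?_).trans (by simp)
      refine (norm_sub_le _ _).trans ?_
      linarith [norm_approxUnitVector_le n (f x), norm_unitVector_le (f x)]
    · rw [lintegral_const]
      exact ENNReal.mul_ne_top (by simp) (measure_ne_top _ _)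
    · have h1 : Tendsto (fun n => ‖approxUnitVector n (f x) - unitVector (f x)‖ₑ) atTop (𝓝 0) := by
        have := ((hlim x).sub_const (unitVector (f x))).enorm
        simpa using this
      have h2 := (ENNReal.continuous_rpow_const (y := 2)).tendsto _ |>.comp h1
      simpa [Function.comp_def] using h2
  have e : ∀ n, eLpNorm ((fun x => approxUnitVector n (f x)) - fun x => unitVector (f x)) 2 μ =
      (∫⁻ x, ‖approxUnitVector n (f x) - unitVector (f x)‖ₑ ^ (2 : ℝ) ∂μ) ^ (1 / (2 : ℝ)) :=
    fun n => by
      rw [eLpNorm_eq_lintegral_rpow_enorm_toReal (by norm_num) (by norm_num)]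
      simp
  simp only [e]
  have h2 := (ENNReal.continuous_rpow_const (y := 1 / (2 : ℝ))).tendsto _ |>.comp hint
  simpa [Function.comp_def] using h2

/-- The superposition operator is not continuous on `L²` (it jumps at `0`), but as a pointwise
limit of continuous operators it preserves strong measurability. -/
lemma aestronglyMeasurable_zetaSuperposition {T : Type*} [MeasurableSpace T] {ν : Measure T}
    {f : T → Lp ℂ 2 μ} (hf : AEStronglyMeasurable f ν) :
    AEStronglyMeasurable (fun t => zetaSuperposition (f t)) ν := by
  obtain ⟨C, hC⟩ := exists_lipschitzWith_zetaLipschitzPart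
  choose D hD using exists_lipschitzWith_approxUnitVector
  simp only [zetaSuperposition_eq]
  refine AEStronglyMeasurable.add ?_ ?_
  · exact aestronglyMeasurable_of_tendsto_ae atTop
      (fun n => ((hD n).continuous_compLp (approxUnitVector_zero n)).comp_aestronglyMeasurable hf)
      (.of_forall fun t => tendsto_compLp_approxUnitVector hD (f t))
  · simp only [← fun t => hC.compLp_eq_toLp zetaLipschitzPart_zero (f t)
      (memLp_zetaLipschitzPart (f t))]
    exact (hC.continuous_compLp zetaLipschitzPart_zero).comp_aestronglyMeasurable hf

lemma exists_norm_zetaSuperposition_le :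
    ∃ C : ℝ, 0 ≤ C ∧ ∀ f : Lp ℂ 2 μ, ‖zetaSuperposition f‖ ≤ C * (1 + ‖f‖) := by
  obtain ⟨C, hC⟩ := exists_lipschitzWith_zetaLipschitzPart
  refine ⟨measureUnivNNReal μ ^ (ENNReal.toReal 2)⁻¹ + C, by positivity, fun f => ?_⟩
  rw [zetaSuperposition_eq]
  have h1 : ‖(memLp_unitVector f).toLp _‖ ≤ measureUnivNNReal μ ^ (ENNReal.toReal 2)⁻¹ := by
    refine (Lp.norm_le_of_ae_bound zero_le_one ?_).trans (by rw [mul_one])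
    filter_upwards [(memLp_unitVector f).coeFn_toLp] with x hx
    rw [hx]
    exact norm_unitVector_le _
  have h2 : ‖(memLp_zetaLipschitzPart f).toLp _‖ ≤ C * ‖f‖ := by
    rw [← hC.compLp_eq_toLp zetaLipschitzPart_zero]
    exact hC.norm_compLp_le zetaLipschitzPart_zero f
  refine (norm_add_le _ _).trans ((add_le_add h1 h2).trans ?_)
  have h3 : (0 : ℝ) ≤ measureUnivNNReal μ ^ (ENNReal.toReal 2)⁻¹ := by positivity
  nlinarith [norm_nonneg f, C.2, mul_nonneg h3 (norm_nonneg f)]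

lemma toLp_unitVector_monotone (f g : Lp ℂ 2 μ) :
    0 ≤ (inner ℂ (f - g) ((memLp_unitVector f).toLp _ - (memLp_unitVector g).toLp _)).re := by
  rw [L2.inner_def]
  refine le_of_le_of_eq ?_ (integral_re (L2.integrable_inner (𝕜 := ℂ) _ _))
  refine integral_nonneg_of_ae ?_
  filter_upwards [Lp.coeFn_sub f g, (memLp_unitVector f).coeFn_toLp,
    (memLp_unitVector g).coeFn_toLp,
    Lp.coeFn_sub ((memLp_unitVector f).toLp _) ((memLp_unitVector g).toLp _)] with x h1 h2 h3 h4
  simp only [h1, h2, h3, h4, Pi.sub_apply]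
  exact unitVector_monotone (f x) (g x)

lemma exists_le_re_inner_zetaSuperposition_sub :
    ∃ K : ℝ, 0 ≤ K ∧ ∀ f g : Lp ℂ 2 μ,
      -(K * ‖f - g‖ ^ 2) ≤ (inner ℂ (f - g) (zetaSuperposition f - zetaSuperposition g)).re := by
  obtain ⟨C, hC⟩ := exists_lipschitzWith_zetaLipschitzPart
  refine ⟨C, C.2, fun f g => ?_⟩
  have h1 : ‖(memLp_zetaLipschitzPart f).toLp _ - (memLp_zetaLipschitzPart g).toLp _‖ ≤
      C * ‖f - g‖ := by
    rw [← hC.compLp_eq_toLp zetaLipschitzPart_zero, ← hC.compLp_eq_toLp zetaLipschitzPart_zero]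
    exact hC.norm_compLp_sub_le zetaLipschitzPart_zero f g
  have h2 : |(inner ℂ (f - g) ((memLp_zetaLipschitzPart f).toLp _ -
      (memLp_zetaLipschitzPart g).toLp _)).re| ≤ C * ‖f - g‖ ^ 2 := by
    refine (Complex.abs_re_le_norm _).trans ((norm_inner_le_norm _ _).trans ?_)
    nlinarith [mul_le_mul_of_nonneg_left h1 (norm_nonneg (f - g))]
  rw [zetaSuperposition_eq, zetaSuperposition_eq, add_sub_add_comm, inner_add_right,
    Complex.add_re]
  linarith [toLp_unitVector_monotone f g, neg_le_of_abs_le h2]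

end Superposition

/-! ### The weak equation in `H¹` -/

section WeakEquation

variable {d : ℕ} {M : Type*} [TopologicalSpace M] [ChartedSpace (EuclideanSpace ℝ (Fin d)) M]
  [T2Space M] [CompactSpace M] [IsManifold (𝓡 d) ∞ M]
  [RiemannianBundle (fun x : M => TangentSpace (𝓡 d) x)]
  [IsContMDiffRiemannianBundle (𝓡 d) ∞ (EuclideanSpace ℝ (Fin d))
    (fun x : M => TangentSpace (𝓡 d) x)]
  [MeasurableSpace M] [BorelSpace M]

variable (d M) in
lemma norm_toL2_le_one : ‖toL2 d M‖ ≤ 1 := by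
  refine ContinuousLinearMap.opNorm_le_bound _ zero_le_one fun v => ?_
  induction v using UniformSpace.Completion.induction_on with
  | hp => exact isClosed_le (by fun_prop) (by fun_prop)
  | ih φ =>
    rw [toL2_coe, UniformSpace.Completion.norm_coe]
    exact smoothToL2Lin_norm_le d M φ

lemma inner_defectOp_toL2 (v u : H1 d M) :
    inner ℂ v (defectOp (toL2 d M) u) = dirichlet d M v u := by
  rw [defectOp_apply, inner_sub_right, inner_adjoint_comp_self, dirichlet]

lemma inner_zetaSuperposition (ψ : SmoothFn d M) (f : Lp ℂ 2 (riemVolume d M)) :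
    inner ℂ (toL2 d M ψ) (zetaSuperposition f) =
      ∫ p, zetaNonlinearity (f p) * conj (ψ p) ∂(riemVolume d M) := by
  rw [L2.inner_def, toL2_coe]
  refine integral_congr_ae ?_
  filter_upwards [(SmoothFn.memLp d M ψ).coeFn_toLp, coeFn_zetaSuperposition f] with p h1 h2
  rw [h1, h2, RCLike.inner_apply]

/-- The integrand, with values in `H¹`, of the weak form of the equation tested in time. -/
noncomputable def weakIntegrand (lam : ℝ) (θ : ℝ → ℝ) (u : ℝ → H1 d M) (t : ℝ) : H1 d M :=
  deriv θ t • ContinuousLinearMap.adjoint (toL2 d M) (toL2 d M (u t)) +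
    θ t • evolutionRHS (toL2 d M) lam u (fun s => zetaSuperposition (toL2 d M (u s))) t

lemma inner_weakIntegrand (lam : ℝ) (θ : ℝ → ℝ) (u : ℝ → H1 d M) (ψ : SmoothFn d M) (t : ℝ) :
    inner ℂ (ψ : H1 d M) (weakIntegrand lam θ u t) = Complex.I *
      (-(Complex.I * inner ℂ (toL2 d M ψ) (toL2 d M (u t)) * ((deriv θ t : ℝ) : ℂ))
        - dirichlet d M ψ (u t) * (θ t : ℂ)
        + Complex.I * lam
          * (∫ p, zetaNonlinearity (toL2 d M (u t) p) * conj (ψ p) ∂(riemVolume d M))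
          * (θ t : ℂ)) := by
  rw [weakIntegrand, inner_add_right, ← Complex.coe_smul, ← Complex.coe_smul, inner_smul_right,
    inner_smul_right, inner_adjoint_comp_self, evolutionRHS, inner_sub_right, inner_neg_right,
    inner_smul_right, inner_smul_right, ContinuousLinearMap.adjoint_inner_right,
    inner_defectOp_toL2, inner_zetaSuperposition]
  linear_combination (inner ℂ (toL2 d M ψ) (toL2 d M (u t)) * ((deriv θ t : ℝ) : ℂ) -
    lam * (∫ p, zetaNonlinearity (toL2 d M (u t) p) * conj (ψ p) ∂(riemVolume d M))
      * (θ t : ℂ)) * Complex.I_sq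

lemma ae_norm_le_of_Linfty (u : Lp (H1 d M) ∞ ((volume : Measure ℝ).restrict (Ici 0))) :
    ∃ B : ℝ, 0 ≤ B ∧ ∀ᵐ t ∂((volume : Measure ℝ).restrict (Ici 0)), ‖u t‖ ≤ B :=
  ⟨_, lpNorm_nonneg, ae_le_lpNorm_exponent_top (Lp.memLp u)⟩

lemma aestronglyMeasurable_zetaSuperposition_toL2
    (u : Lp (H1 d M) ∞ ((volume : Measure ℝ).restrict (Ici 0))) :
    AEStronglyMeasurable (fun t => zetaSuperposition (toL2 d M (u t)))
      ((volume : Measure ℝ).restrict (Ici 0)) :=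
  aestronglyMeasurable_zetaSuperposition
    ((toL2 d M).continuous.comp_aestronglyMeasurable (Lp.aestronglyMeasurable u))

lemma ae_norm_zetaSuperposition_toL2_le
    (u : Lp (H1 d M) ∞ ((volume : Measure ℝ).restrict (Ici 0))) :
    ∃ D : ℝ, 0 ≤ D ∧ ∀ᵐ t ∂((volume : Measure ℝ).restrict (Ici 0)),
      ‖zetaSuperposition (toL2 d M (u t))‖ ≤ D := by
  obtain ⟨B, hB0, hB⟩ := ae_norm_le_of_Linfty u
  obtain ⟨C, hC0, hC⟩ := exists_norm_zetaSuperposition_le (μ := riemVolume d M)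
  refine ⟨C * (1 + B), by positivity, ?_⟩
  filter_upwards [hB] with t ht
  refine (hC _).trans ?_
  gcongr
  exact (norm_apply_le_of_contraction (norm_toL2_le_one d M) _).trans ht

lemma integrable_weakIntegrand {lam : ℝ} (hlam : 0 ≤ lam) {θ : ℝ → ℝ} (hθ : ContDiff ℝ ∞ θ)
    (hθc : HasCompactSupport θ) (u : Lp (H1 d M) ∞ ((volume : Measure ℝ).restrict (Ici 0))) :
    Integrable (weakIntegrand lam θ u) ((volume : Measure ℝ).restrict (Ici 0)) := by
  obtain ⟨B, -, hB⟩ := ae_norm_le_of_Linfty u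
  obtain ⟨D, -, hD⟩ := ae_norm_zetaSuperposition_toL2_le u
  have hJ := norm_toL2_le_one d M
  have hm := Lp.aestronglyMeasurable u
  have h1 : MemLp (fun t => ContinuousLinearMap.adjoint (toL2 d M) (toL2 d M (u t))) ∞
      ((volume : Measure ℝ).restrict (Ici 0)) :=
    memLp_top_of_bound ((ContinuousLinearMap.adjoint (toL2 d M)).continuous.comp_aestronglyMeasurable
      ((toL2 d M).continuous.comp_aestronglyMeasurable hm)) B (by
        filter_upwards [hB] with t ht
        exact (norm_adjoint_le_of_contraction hJ _).trans
          ((norm_apply_le_of_contraction hJ _).trans ht))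
  have h2 := memLp_top_of_bound (aestronglyMeasurable_evolutionRHS (J := toL2 d M) (lam := lam) hm
    (aestronglyMeasurable_zetaSuperposition_toL2 u)) _ (norm_evolutionRHS_le hJ hlam hB hD)
  exact ((h1.locallyIntegrable le_top).integrable_smul_left_of_hasCompactSupport
      (hθ.continuous_deriv (by simp)) hθc.deriv).add
    ((h2.locallyIntegrable le_top).integrable_smul_left_of_hasCompactSupport hθ.continuous hθc)

/-- The distributional equation, tested against all `ψ`, is an identity between elements of `H¹`:
smooth functions are dense there. -/
lemma IsDistribSolution.integral_weakIntegrand {lam : ℝ} (hlam : 0 ≤ lam) {u₀ : H1 d M}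
    {u : Lp (H1 d M) ∞ ((volume : Measure ℝ).restrict (Ici 0))}
    (hu : IsDistribSolution d lam u₀ u) {θ : ℝ → ℝ} (hθ : ContDiff ℝ ∞ θ)
    (hθc : HasCompactSupport θ) :
    ∫ t in Ici (0 : ℝ), weakIntegrand lam θ u t =
      -((θ 0 : ℂ) • ContinuousLinearMap.adjoint (toL2 d M) (toL2 d M u₀)) := by
  refine ext_inner_left ℂ fun v => ?_
  induction v using UniformSpace.Completion.induction_on with
  | hp => exact isClosed_eq (by fun_prop) (by fun_prop)
  | ih ψ =>
    rw [← integral_inner (integrable_weakIntegrand hlam hθ hθc u)]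
    simp only [inner_weakIntegrand]
    rw [integral_const_mul, hu θ ψ hθ hθc, inner_neg_right, inner_smul_right,
      inner_adjoint_comp_self]
    linear_combination (inner ℂ (toL2 d M ψ) (toL2 d M u₀) * (θ 0 : ℂ)) * Complex.I_sq

end WeakEquation

/-- Let `M` be a compact Riemannian manifold (of any dimension `d`, without boundary) and `lam > 0`.
Two distributional solutions in `L^∞(ℝ₊; H¹(M))` of `i ∂ₜu + Δu + i lam u ζ(|u| + 1) = 0` with the
same initial data coincide. -/
theorem mainTheorem2 (d : ℕ) (M : Type*) [TopologicalSpace M]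
    [ChartedSpace (EuclideanSpace ℝ (Fin d)) M] [T2Space M] [CompactSpace M]
    [IsManifold (𝓡 d) ∞ M] [RiemannianBundle (fun x : M => TangentSpace (𝓡 d) x)]
    [IsContMDiffRiemannianBundle (𝓡 d) ∞ (EuclideanSpace ℝ (Fin d))
      (fun x : M => TangentSpace (𝓡 d) x)]
    [MeasurableSpace M] [BorelSpace M] (lam : ℝ) (hlam : 0 < lam) (u₀ : H1 d M)
    (u₁ u₂ : Lp (H1 d M) ∞ ((volume : Measure ℝ).restrict (Ici 0)))
    (h₁ : IsDistribSolution d lam u₀ u₁) (h₂ : IsDistribSolution d lam u₀ u₂) :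
    u₁ = u₂ := by
  obtain ⟨K, hK, hmono⟩ := exists_le_re_inner_zetaSuperposition_sub (μ := riemVolume d M)
  obtain ⟨B₁, hB₁, hu₁⟩ := ae_norm_le_of_Linfty u₁
  obtain ⟨B₂, hB₂, hu₂⟩ := ae_norm_le_of_Linfty u₂
  obtain ⟨D₁, hD₁, hN₁⟩ := ae_norm_zetaSuperposition_toL2_le u₁
  obtain ⟨D₂, hD₂, hN₂⟩ := ae_norm_zetaSuperposition_toL2_le u₂
  -- extension by zero to negative times, where elements of `L^∞(ℝ₊)` have arbitrary values
  set w : ℝ → H1 d M := (Ici 0).indicator fun t => u₁ t - u₂ t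
  set G : ℝ → Lp ℂ 2 (riemVolume d M) := (Ici 0).indicator fun t =>
    zetaSuperposition (toL2 d M (u₁ t)) - zetaSuperposition (toL2 d M (u₂ t))
  have hwt : ∀ t ∈ Ici (0 : ℝ), w t = u₁ t - u₂ t := fun t ht => indicator_of_mem ht _
  have hGt : ∀ t ∈ Ici (0 : ℝ), G t = zetaSuperposition (toL2 d M (u₁ t)) -
      zetaSuperposition (toL2 d M (u₂ t)) := fun t ht => indicator_of_mem ht _
  have hw0 : ∀ t ∉ Ici (0 : ℝ), w t = 0 := fun t ht => indicator_of_notMem ht _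
  have hG0 : ∀ t ∉ Ici (0 : ℝ), G t = 0 := fun t ht => indicator_of_notMem ht _
  have hwm : AEStronglyMeasurable w volume :=
    (aestronglyMeasurable_indicator_iff measurableSet_Ici).2
      ((Lp.aestronglyMeasurable u₁).sub (Lp.aestronglyMeasurable u₂))
  have hGm : AEStronglyMeasurable G volume :=
    (aestronglyMeasurable_indicator_iff measurableSet_Ici).2
      ((aestronglyMeasurable_zetaSuperposition_toL2 u₁).sub
        (aestronglyMeasurable_zetaSuperposition_toL2 u₂))
  rw [ae_restrict_iff' measurableSet_Ici] at hu₁ hu₂ hN₁ hN₂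
  have hwb : ∀ᵐ t, ‖w t‖ ≤ B₁ + B₂ := by
    filter_upwards [hu₁, hu₂] with t a b
    by_cases ht : t ∈ Ici (0 : ℝ)
    · rw [hwt t ht]
      exact (norm_sub_le _ _).trans (add_le_add (a ht) (b ht))
    · rw [hw0 t ht, norm_zero]
      positivity
  have hGb : ∀ᵐ t, ‖G t‖ ≤ D₁ + D₂ := by
    filter_upwards [hN₁, hN₂] with t a b
    by_cases ht : t ∈ Ici (0 : ℝ)
    · rw [hGt t ht]
      exact (norm_sub_le _ _).trans (add_le_add (a ht) (b ht))
    · rw [hG0 t ht, norm_zero]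
      positivity
  have hmain := ae_eq_zero_of_weak_evolution (norm_toL2_le_one d M) hlam.le hwm hGm hwb hGb hK
    (fun t => ?_) (fun t hJ => ?_) (fun θ hθ hθc => ?_)
  · refine Lp.ext ?_
    filter_upwards [hmain, ae_restrict_mem measurableSet_Ici] with t ht ht0
    rw [hwt t ht0] at ht
    exact sub_eq_zero.1 ht
  · by_cases ht : t ∈ Ici (0 : ℝ)
    · rw [hwt t ht, hGt t ht, map_sub]
      exact hmono _ _
    · simp [hw0 t ht]
  · by_cases ht : t ∈ Ici (0 : ℝ)
    · rw [hwt t ht, map_sub, sub_eq_zero] at hJ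
      rw [hGt t ht, hJ, sub_self]
    · exact hG0 t ht
  · have e : ∀ t ∈ Ici (0 : ℝ), deriv θ t • ContinuousLinearMap.adjoint (toL2 d M)
        (toL2 d M (w t)) + θ t • evolutionRHS (toL2 d M) lam w G t =
        weakIntegrand lam θ u₁ t - weakIntegrand lam θ u₂ t := fun t ht => by
      simp only [weakIntegrand, evolutionRHS, hwt t ht, hGt t ht, map_sub, smul_sub, smul_neg]
      abel
    rw [setIntegral_congr_fun measurableSet_Ici e,
      integral_sub (integrable_weakIntegrand hlam.le hθ hθc u₁)
        (integrable_weakIntegrand hlam.le hθ hθc u₂),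
      h₁.integral_weakIntegrand hlam.le hθ hθc, h₂.integral_weakIntegrand hlam.le hθ hθc, sub_self]
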